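/- Let $H$ be a complex Hilbert space and let $\mathcal{CF}^{sa}(H)$ be the set of all (generally unbounded, densely defined) selfadjoint Fredholm operators $T:\mathcal{D}(T)\subset H\to H$ (Fredholm: closed, with $\dim\ker T<\infty$ and $\operatorname{codim}\operatorname{im}T<\infty$), with the gap metric $d_G(T,S)=\|\kappa(T)-\kappa(S)\|$, where $\kappa(T)=(T-i)(T+i)^{-1}\in\mathcal{L}(H)$ is the Cayley transform. Let $\rho(T)$ be the resolvent set of $T$. For $c<d$ in $\rho(T)$ let $\chi_{[c,d]}(T)=\frac{1}{2\pi i}\int_\Gamma(\lambda-T)^{-1}\,d\lambda$, where $\Gamma$ is the circle of radius $\frac{d-c}{2}$ around $\frac{c+d}{2}$, and let $E_{[c,d]}(T)=\bigoplus_{\mu\in[c,d]}\ker(\mu-T)$. Let $I=[0,1]$ and let $\mathcal{A}:I\to\mathcal{CF}^{sa}(H)$ be continuous for the gap metric. Call a partition $0=\lambda_0\le\lambda_1\le\dots\le\lambda_n=1$ together with levels $a_1,\dots,a_n>0$ admissible for $\mathcal{A}$ if, for each $i=1,\dots,n$, one has $\pm a_i\in\rho(\mathcal{A}_\lambda)$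 for all $\lambda\in[\lambda_{i-1},\lambda_i]$ and the map $[\lambda_{i-1},\lambda_i]\ni\lambda\mapsto\chi_{[-a_i,a_i]}(\mathcal{A}_\lambda)\in\mathcal{L}(H)$ is norm continuous and of constant finite rank. Then admissible partitions with levels exist. For each of them the spaces $E_{[0,a_i]}(\mathcal{A}_\lambda)$, $\lambda\in[\lambda_{i-1},\lambda_i]$, are finite-dimensional, and the integer \[\operatorname{sfl}(\mathcal{A})=\sum_{i=1}^n\bigl(\dim E_{[0,a_i]}(\mathcal{A}_{\lambda_i})-\dim E_{[0,a_i]}(\mathcal{A}_{\lambda_{i-1}})\bigr)\] is the same for all admissible choices of $n$, $\lambda_0,\dots,\lambda_n$ and $a_1,\dots,a_n$. Hence the spectral flow $\operatorname{sfl}(\mathcal{A})$ is well defined and depends only on the continuous map $\mathcal{A}$. -/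

import Mathlib

namespace SpectralFlow

noncomputable section

variable {H : Type*} [NormedAddCommGroup H] [InnerProductSpace ℂ H]

/-- The operator `z - T` on the domain of `T`. -/
def subOp (T : H →ₗ.[ℂ] H) (z : ℂ) : T.domain →ₗ[ℂ] H :=
  z • T.domain.subtype - T.toFun

theorem subOp_apply (T : H →ₗ.[ℂ] H) (z : ℂ) (u : T.domain) :
    subOp T z u = z • (u : H) - T u := rfl

/-- The resolvent set of `T`: all `z` such that `z - T` maps the domain of `T` bijectively onto `H`
and the inverse is a bounded operator on `H`. -/
def resolventSet (T : H →ₗ.[ℂ] H) : Set ℂ :=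
  {z | Function.Bijective (subOp T z) ∧ ∃ R : H →L[ℂ] H, ∀ u : T.domain, R (subOp T z u) = u}

open Classical in
/-- The resolvent `(z - T)⁻¹` as a bounded operator on `H`
(with the value `0` if `z` is not in the resolvent set). -/
def resolventOp (T : H →ₗ.[ℂ] H) (z : ℂ) : H →L[ℂ] H :=
  if h : z ∈ resolventSet T then h.2.choose else 0

theorem resolventOp_subOp {T : H →ₗ.[ℂ] H} {z : ℂ} (h : z ∈ resolventSet T) (u : T.domain) :
    resolventOp T z (subOp T z u) = u := by
  rw [resolventOp, dif_pos h]
  exact h.2.choose_spec u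

/-- A Fredholm operator: closed, with kernel of finite dimension and range of finite
codimension. -/
def IsFredholm (T : H →ₗ.[ℂ] H) : Prop :=
  T.IsClosed ∧ FiniteDimensional ℂ (LinearMap.ker T.toFun) ∧
    FiniteDimensional ℂ (H ⧸ LinearMap.range T.toFun)

/-- The eigenspace `ker (z - T)`, as a subspace of `H`. -/
def eigenspace (T : H →ₗ.[ℂ] H) (z : ℂ) : Submodule ℂ H :=
  (LinearMap.ker (subOp T z)).map T.domain.subtype

/-- The sum `E_{[c,d]}(T)` of the eigenspaces `ker (μ - T)` over all `μ ∈ [c, d]`. (The sum is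
direct, since eigenvectors for distinct eigenvalues are linearly independent.) -/
def eigenspaceSum (T : H →ₗ.[ℂ] H) (c d : ℝ) : Submodule ℂ H :=
  ⨆ μ ∈ Set.Icc c d, eigenspace T (μ : ℂ)

/-- The spectral projection `χ_{[c,d]}(T) = (2πi)⁻¹ ∮ (z - T)⁻¹ dz`, where the integral is over the
circle of radius `(d - c) / 2` around `(c + d) / 2`. It is used only if `c` and `d` belong to the
resolvent set of `T`. -/
def spectralProjection [CompleteSpace H] (T : H →ₗ.[ℂ] H) (c d : ℝ) : H →L[ℂ] H :=
  (2 * (Real.pi : ℂ) * Complex.I)⁻¹ •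
    ∮ z in C((((c + d) / 2 : ℝ) : ℂ), (d - c) / 2), resolventOp T z

section Cayley

variable [CompleteSpace H]

theorem norm_subOp_sq {T : H →ₗ.[ℂ] H} (hT : IsSelfAdjoint T) (u : T.domain) :
    ‖subOp T (-Complex.I) u‖ ^ 2 = ‖(u : H)‖ ^ 2 + ‖T u‖ ^ 2 := by
  have hs : inner ℂ (T u) (u : H) = inner ℂ (u : H) (T u) := by
    have h := LinearPMap.adjoint_isFormalAdjoint hT.dense_domain
    rw [LinearPMap.isSelfAdjoint_def.mp hT] at h
    exact h u u
  have him : (inner ℂ (u : H) (T u)).im = 0 := by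
    have h := inner_conj_symm (𝕜 := ℂ) (u : H) (T u)
    rw [hs] at h
    exact Complex.conj_eq_iff_im.mp h
  rw [subOp_apply, @norm_sub_sq ℂ, norm_smul, inner_smul_left]
  simp [him]

theorem neg_I_mem_resolventSet {T : H →ₗ.[ℂ] H} (hT : IsSelfAdjoint T) :
    -Complex.I ∈ resolventSet T := by
  have hle : ∀ u : T.domain, ‖(u : H)‖ ≤ ‖subOp T (-Complex.I) u‖ := fun u => by
    have := norm_subOp_sq hT u
    exact le_of_sq_le_sq (by nlinarith [sq_nonneg ‖T u‖]) (norm_nonneg _)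
  have hle' : ∀ u : T.domain, ‖T u‖ ≤ ‖subOp T (-Complex.I) u‖ := fun u => by
    have := norm_subOp_sq hT u
    exact le_of_sq_le_sq (by nlinarith [sq_nonneg ‖(u : H)‖]) (norm_nonneg _)
  have hinj : Function.Injective (subOp T (-Complex.I)) := by
    rw [← LinearMap.ker_eq_bot, LinearMap.ker_eq_bot']
    intro u hu
    have := hle u
    rw [hu, norm_zero] at this
    exact Subtype.ext (norm_le_zero_iff.mp this)
  have hclosed : IsClosed (LinearMap.range (subOp T (-Complex.I)) : Set H) := by
    have hg : IsClosed (T.graph : Set (H × H)) := hT.isClosed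
    have : CompleteSpace T.graph := hg.completeSpace_coe
    let Φ : T.graph →L[ℂ] H :=
      ((-Complex.I) • ContinuousLinearMap.fst ℂ H H - ContinuousLinearMap.snd ℂ H H).comp
        T.graph.subtypeL
    have hΦ : ∀ x : T.graph, ‖x‖ ≤ (1 : NNReal) * ‖Φ x‖ := by
      rintro ⟨x, hx⟩
      obtain ⟨u, rfl⟩ := (LinearPMap.mem_graph_iff' T).mp hx
      rw [NNReal.coe_one, one_mul]
      exact max_le (hle u) (hle' u)
    have hc := (ContinuousLinearMap.antilipschitz_of_bound Φ hΦ).isClosed_range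
      Φ.uniformContinuous
    convert hc using 1
    ext v
    constructor
    · rintro ⟨u, rfl⟩
      exact ⟨⟨(u, T u), T.mem_graph u⟩, rfl⟩
    · rintro ⟨⟨x, hx⟩, rfl⟩
      obtain ⟨u, rfl⟩ := (LinearPMap.mem_graph_iff' T).mp hx
      exact ⟨u, rfl⟩
  have hperp : (LinearMap.range (subOp T (-Complex.I)))ᗮ = ⊥ := by
    rw [Submodule.eq_bot_iff]
    intro y hy
    have h1 : ∀ u : T.domain, inner ℂ (Complex.I • y) (u : H) = inner ℂ y (T u) := fun u => by
      have := (Submodule.mem_orthogonal' _ _).mp hy _ ⟨u, rfl⟩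
      rw [subOp_apply, inner_sub_right, inner_smul_right, sub_eq_zero] at this
      rw [← this, inner_smul_left, Complex.conj_I]
    have hya := LinearPMap.mem_adjoint_domain_of_exists (T := T) y ⟨_, h1⟩
    have hyT := LinearPMap.adjoint_apply_eq hT.dense_domain ⟨y, hya⟩ h1
    have key : ∃ hyd : y ∈ T.domain, T ⟨y, hyd⟩ = Complex.I • y := by
      have e : ∀ S : H →ₗ.[ℂ] H, S = T → ∀ hS : y ∈ S.domain, S ⟨y, hS⟩ = Complex.I • y →
          ∃ hyd : y ∈ T.domain, T ⟨y, hyd⟩ = Complex.I • y := by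
        rintro S rfl hS h
        exact ⟨hS, h⟩
      exact e _ (LinearPMap.isSelfAdjoint_def.mp hT) hya hyT
    obtain ⟨hyd, hyT⟩ := key
    have h2 := h1 ⟨y, hyd⟩
    rw [hyT, inner_smul_left, inner_smul_right, Complex.conj_I, neg_mul,
      neg_eq_iff_add_eq_zero, ← two_mul] at h2
    simpa using h2
  have hsurj : Function.Surjective (subOp T (-Complex.I)) := by
    have : CompleteSpace (LinearMap.range (subOp T (-Complex.I))) := hclosed.completeSpace_coe
    rw [← LinearMap.range_eq_top]
    exact (Submodule.orthogonal_eq_bot_iff).mp hperp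
  refine ⟨⟨hinj, hsurj⟩, ?_⟩
  let e := LinearEquiv.ofBijective (subOp T (-Complex.I)) ⟨hinj, hsurj⟩
  refine ⟨(T.domain.subtype ∘ₗ e.symm.toLinearMap).mkContinuous 1 fun v => ?_, fun u => ?_⟩
  · have := hle (e.symm v)
    rw [one_mul]
    calc ‖((e.symm v : T.domain) : H)‖ ≤ ‖e (e.symm v)‖ := this
      _ = ‖v‖ := by rw [e.apply_symm_apply]
  · change ((e.symm (e u) : T.domain) : H) = u
    rw [e.symm_apply_apply]

/-- The Cayley transform `κ(T) = (T - i)(T + i)⁻¹ = 1 - 2i (T + i)⁻¹` of a selfadjoint operator,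
where `(T + i)⁻¹ = -(-i - T)⁻¹`. -/
def cayley (T : H →ₗ.[ℂ] H) : H →L[ℂ] H :=
  ContinuousLinearMap.id ℂ H - (2 * Complex.I) • (-resolventOp T (-Complex.I))

/-- The Cayley transform is the operator `(T - i)(T + i)⁻¹`: it maps `(T + i) u` to `(T - i) u`. -/
theorem cayley_apply {T : H →ₗ.[ℂ] H} (hT : IsSelfAdjoint T) (u : T.domain) :
    cayley T (T u + Complex.I • (u : H)) = T u - Complex.I • (u : H) := by
  have h := resolventOp_subOp (neg_I_mem_resolventSet hT) u
  have e : T u + Complex.I • (u : H) = -subOp T (-Complex.I) u := by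
    rw [subOp_apply]; module
  have h' : (-resolventOp T (-Complex.I)) (T u + Complex.I • (u : H)) = u := by
    rw [e, neg_apply, map_neg, h, neg_neg]
  simp only [cayley, sub_apply, smul_apply, h',
    ContinuousLinearMap.id_apply]
  module

theorem cayley_injOn {T S : H →ₗ.[ℂ] H} (hT : IsSelfAdjoint T) (hS : IsSelfAdjoint S)
    (h : cayley T = cayley S) : T = S := by
  have hR : resolventOp T (-Complex.I) = resolventOp S (-Complex.I) := by
    have h2 : (2 * Complex.I : ℂ) ≠ 0 := by simp
    exact neg_injective (smul_right_injective _ h2 (sub_right_injective h))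
  have key : ∀ {T S : H →ₗ.[ℂ] H}, IsSelfAdjoint T → IsSelfAdjoint S →
      resolventOp T (-Complex.I) = resolventOp S (-Complex.I) → T ≤ S := by
    intro T S hT hS hR
    have hx : ∀ u : T.domain, ∃ w : S.domain, (u : H) = w ∧ T u = S w := fun u => by
      obtain ⟨w, hw⟩ := (neg_I_mem_resolventSet hS).1.2 (subOp T (-Complex.I) u)
      have h1 := resolventOp_subOp (neg_I_mem_resolventSet hT) u
      rw [hR, ← hw, resolventOp_subOp (neg_I_mem_resolventSet hS)] at h1
      refine ⟨w, h1.symm, ?_⟩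
      rw [subOp_apply, subOp_apply, h1] at hw
      exact (sub_right_injective hw).symm
    refine ⟨fun x hx' => ?_, fun x y hxy => ?_⟩
    · obtain ⟨w, hw, -⟩ := hx ⟨x, hx'⟩
      have hw' : x = w := hw
      rw [hw']
      exact w.2
    · obtain ⟨w, hw, hw'⟩ := hx x
      rw [hw', Subtype.ext (hw.symm.trans hxy)]
  exact le_antisymm (key hT hS hR) (key hS hT hR.symm)

variable (H) in
/-- The set `CF^sa(H)` of all (generally unbounded) selfadjoint Fredholm operators on `H`. A
selfadjoint partially defined operator is densely defined by `IsSelfAdjoint.dense_domain`. -/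
def CFsa : Type _ := {T : H →ₗ.[ℂ] H // IsSelfAdjoint T ∧ IsFredholm T}

/-- The underlying unbounded operator. -/
def CFsa.op (T : CFsa H) : H →ₗ.[ℂ] H := T.1

/-- The gap metric `d_G(T, S) = ‖κ(T) - κ(S)‖` on `CF^sa(H)`. -/
instance CFsa.instMetricSpace : MetricSpace (CFsa H) :=
  MetricSpace.induced (fun T : CFsa H => cayley T.op)
    (fun T S h => Subtype.ext (cayley_injOn T.2.1 S.2.1 h)) inferInstance

theorem dist_eq (T S : CFsa H) : dist T S = ‖cayley T.op - cayley S.op‖ :=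
  dist_eq_norm (cayley T.op) (cayley S.op)

/-- The choices that enter the definition of the spectral flow of `A`: instants
`0 = t₀ ≤ t₁ ≤ ⋯ ≤ tₙ = 1` and levels `a₁, …, aₙ > 0` such that, on every `[tᵢ₋₁, tᵢ]`, the numbers
`± aᵢ` belong to the resolvent set of `A s`, and the map `s ↦ χ_{[-aᵢ,aᵢ]}(A s)` is continuous and of
constant finite rank. (The level `aᵢ` is `a (i - 1)` in the indexing by `Fin n`.) -/
structure IsAdmissible (A : unitInterval → CFsa H) {n : ℕ} (t : Fin (n + 1) → unitInterval)
    (a : Fin n → ℝ) : Prop where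
  monotone : Monotone t
  first : t 0 = 0
  last : t (Fin.last n) = 1
  pos : ∀ i, 0 < a i
  mem_resolventSet : ∀ i, ∀ s ∈ Set.Icc (t i.castSucc) (t i.succ),
    ((a i : ℝ) : ℂ) ∈ resolventSet (A s).op ∧ ((-a i : ℝ) : ℂ) ∈ resolventSet (A s).op
  continuousOn : ∀ i, ContinuousOn (fun s => spectralProjection (A s).op (-a i) (a i))
    (Set.Icc (t i.castSucc) (t i.succ))
  rank : ∀ i, ∃ r : ℕ, ∀ s ∈ Set.Icc (t i.castSucc) (t i.succ),
    Module.rank ℂ (LinearMap.range (spectralProjection (A s).op (-a i) (a i)).toLinearMap) = r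

/-- The sum `∑ᵢ (dim E_{[0,aᵢ]}(A_{tᵢ}) - dim E_{[0,aᵢ]}(A_{tᵢ₋₁}))`. -/
def flowSum (A : unitInterval → CFsa H) {n : ℕ} (t : Fin (n + 1) → unitInterval)
    (a : Fin n → ℝ) : ℤ :=
  ∑ i : Fin n,
    ((Module.finrank ℂ (eigenspaceSum (A (t i.succ)).op 0 (a i)) : ℤ) -
      (Module.finrank ℂ (eigenspaceSum (A (t i.castSucc)).op 0 (a i)) : ℤ))

end Cayley

end

end SpectralFlow

namespace SpectralFlow

noncomputable section

variable {H : Type*} [NormedAddCommGroup H] [InnerProductSpace ℂ H]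

/-! For a selfadjoint Fredholm operator `0` is at most an isolated point of the spectrum, and
spectral projections between two levels in the resolvent set move continuously with the operator, so
that their ranks are locally constant. Everything follows from these two facts.

Unboundedness is removed by working with `R = (-i - T)⁻¹`, of which the Cayley transform is an
affine function. Since `z - T = (1 + (z + i) R)(-i - T)`, lying in the resolvent set is an open
condition in the gap metric, and resolvents and their contour integrals are continuous in `T`
(`continuousOn_spectralProjection`). As `R` is normal, `χ_{[c,d]}(T)` is a function of `R` whose
symbol is the indicator of `[c,d]` on the spectrum (`spectralProjection_eq_cfc`,
`spectralSymbol_cases`). It is therefore idempotent, and if its range is finite-dimensional, that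
range is `E_{[c,d]}(T)` (`range_spectralProjection_eq`).

Existence: a small level around `0` works near each operator (`exists_level`), and compactness of
the unit interval yields a partition.

Independence: if levels `a ≤ b` are both admissible over `[p,q]`, then `dim E_{[0,b]} - dim
E_{[0,a]}` is the rank of `χ_{[a,b]}`, which is constant on `[p,q]`. Hence both levels give the same
increment (`finrank_sub_eq_finrank_sub`), and two partitions are compared on their common refinement
(`sum_sub_eq_sum_sub`). -/

/-! ### Resolvent identities and reduction to a bounded pencil. -/

theorem exists_resolventOp_eq {T : H →ₗ.[ℂ] H} {z : ℂ} (h : z ∈ resolventSet T) (y : H) :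
    ∃ u : T.domain, resolventOp T z y = u ∧ subOp T z u = y := by
  obtain ⟨u, rfl⟩ := h.1.2 y
  exact ⟨u, resolventOp_subOp h u, rfl⟩

theorem resolventOp_sub_resolventOp {T : H →ₗ.[ℂ] H} {w z : ℂ} (hw : w ∈ resolventSet T)
    (hz : z ∈ resolventSet T) :
    resolventOp T w - resolventOp T z = (z - w) • (resolventOp T w * resolventOp T z) := by
  ext y
  obtain ⟨u, hu, rfl⟩ := exists_resolventOp_eq hz y
  have e : subOp T z u = (z - w) • (u : H) + subOp T w u := by
    rw [subOp_apply, subOp_apply]; module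
  have h1 : resolventOp T w (subOp T z u) = (z - w) • resolventOp T w u + u := by
    rw [e, map_add, map_smul, resolventOp_subOp hw]
  simp only [sub_apply, smul_apply, mul_apply_eq_comp, hu, h1]
  simp

theorem commute_resolventOp {T : H →ₗ.[ℂ] H} {w z : ℂ} (hw : w ∈ resolventSet T)
    (hz : z ∈ resolventSet T) : Commute (resolventOp T w) (resolventOp T z) := by
  rcases eq_or_ne w z with rfl | h
  · exact Commute.refl _
  · have h1 := resolventOp_sub_resolventOp hw hz
    have h2 := resolventOp_sub_resolventOp hz hw
    have h3 : (z - w) • (resolventOp T w * resolventOp T z)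
        = (z - w) • (resolventOp T z * resolventOp T w) := by
      rw [← h1, ← neg_sub, h2, ← neg_smul, neg_sub]
    exact smul_right_injective _ (sub_ne_zero.mpr h.symm) h3

/-- The value at `z` of the pencil `1 + (z + i) (-i - T)⁻¹`, which is invertible exactly for `z` in
the resolvent set. -/
def pencil (T : H →ₗ.[ℂ] H) (z : ℂ) : H →L[ℂ] H :=
  1 + (z + Complex.I) • resolventOp T (-Complex.I)

theorem pencil_subOp {T : H →ₗ.[ℂ] H} (hT : -Complex.I ∈ resolventSet T) (z : ℂ) (u : T.domain) :
    pencil T z (subOp T (-Complex.I) u) = subOp T z u := by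
  rw [pencil, add_apply, smul_apply, resolventOp_subOp hT, one_apply_eq_self, subOp_apply,
    subOp_apply]
  module

/-- The factorisation `z - T = pencil T z ∘ (-i - T)` turns a question about an unbounded operator
into invertibility in a Banach algebra. By the resolvent identity the inverse of the pencil is `1 -
(z + i)(z - T)⁻¹`. -/
theorem mem_resolventSet_iff_isUnit {T : H →ₗ.[ℂ] H} (hT : -Complex.I ∈ resolventSet T) (z : ℂ) :
    z ∈ resolventSet T ↔ IsUnit (pencil T z) := by
  constructor
  · intro hz
    have h1 := resolventOp_sub_resolventOp hT hz
    have h2 := (commute_resolventOp hT hz).eq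
    rw [sub_neg_eq_add] at h1
    have key : resolventOp T (-Complex.I) - resolventOp T z
        - (z + Complex.I) • (resolventOp T (-Complex.I) * resolventOp T z) = 0 := by
      rw [h1, sub_self]
    refine ⟨⟨pencil T z, 1 - (z + Complex.I) • resolventOp T z, ?_, ?_⟩, rfl⟩
    · calc pencil T z * (1 - (z + Complex.I) • resolventOp T z)
          = 1 + (z + Complex.I) • (resolventOp T (-Complex.I) - resolventOp T z
            - (z + Complex.I) • (resolventOp T (-Complex.I) * resolventOp T z)) := by
            simp only [pencil, add_mul, mul_sub, one_mul, mul_one, smul_mul_smul_comm, smul_sub,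
              smul_smul]
            abel
        _ = 1 := by rw [key, smul_zero, add_zero]
    · calc (1 - (z + Complex.I) • resolventOp T z) * pencil T z
          = 1 + (z + Complex.I) • (resolventOp T (-Complex.I) - resolventOp T z
            - (z + Complex.I) • (resolventOp T z * resolventOp T (-Complex.I))) := by
            simp only [pencil, sub_mul, mul_add, one_mul, mul_one, smul_mul_smul_comm, smul_sub,
              smul_smul]
            abel
        _ = 1 := by rw [← h2, key, smul_zero, add_zero]
  · rintro ⟨V, hV⟩
    have hV1 : ∀ x, (↑V⁻¹ : H →L[ℂ] H) (pencil T z x) = x := fun x => by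
      rw [← hV, ← mul_apply_eq_comp, V.inv_mul, one_apply_eq_self]
    have hV2 : ∀ x, pencil T z ((↑V⁻¹ : H →L[ℂ] H) x) = x := fun x => by
      rw [← hV, ← mul_apply_eq_comp, V.mul_inv, one_apply_eq_self]
    have hinv : ∀ u : T.domain,
        (resolventOp T (-Complex.I) * (↑V⁻¹ : H →L[ℂ] H)) (subOp T z u) = u := fun u => by
      rw [mul_apply_eq_comp, ← pencil_subOp hT, hV1, resolventOp_subOp hT]
    refine ⟨⟨fun u v huv => Subtype.ext ?_, fun y => ?_⟩, _, hinv⟩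
    · rw [← hinv u, huv, hinv v]
    · obtain ⟨u, hu⟩ := hT.1.2 ((↑V⁻¹ : H →L[ℂ] H) y)
      exact ⟨u, by rw [← pencil_subOp hT, hu, hV2]⟩

theorem resolventOp_eq_mul_inverse {T : H →ₗ.[ℂ] H} (hT : -Complex.I ∈ resolventSet T) {z : ℂ}
    (hz : z ∈ resolventSet T) :
    resolventOp T z = resolventOp T (-Complex.I) * Ring.inverse (pencil T z) := by
  have hu := (mem_resolventSet_iff_isUnit hT z).mp hz
  have : resolventOp T z * pencil T z = resolventOp T (-Complex.I) := by
    ext y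
    obtain ⟨u, hu, rfl⟩ := exists_resolventOp_eq hT y
    rw [mul_apply_eq_comp, pencil_subOp hT, resolventOp_subOp hz, hu]
  rw [← this, mul_assoc, Ring.mul_inverse_cancel _ hu, mul_one]

/-! ### Resolvents of selfadjoint operators. -/

section Selfadjoint

variable [CompleteSpace H]

theorem inner_map_eq {T : H →ₗ.[ℂ] H} (hT : IsSelfAdjoint T) (u v : T.domain) :
    inner ℂ (T u) (v : H) = inner ℂ (u : H) (T v) := by
  have h := LinearPMap.adjoint_isFormalAdjoint hT.dense_domain
  rw [LinearPMap.isSelfAdjoint_def.mp hT] at h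
  exact h u v

theorem inner_subOp_eq {T : H →ₗ.[ℂ] H} (hT : IsSelfAdjoint T) (z : ℂ) (u v : T.domain) :
    inner ℂ (subOp T (starRingEnd ℂ z) u) (v : H) = inner ℂ (u : H) (subOp T z v) := by
  simp only [subOp_apply, inner_sub_left, inner_sub_right, inner_smul_left, inner_smul_right,
    inner_map_eq hT, Complex.conj_conj]

theorem exists_mem_domain_of_inner {T : H →ₗ.[ℂ] H} (hT : IsSelfAdjoint T) {y w : H}
    (h : ∀ u : T.domain, inner ℂ w (u : H) = inner ℂ y (T u)) :
    ∃ hy : y ∈ T.domain, T ⟨y, hy⟩ = w := by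
  have hya := LinearPMap.mem_adjoint_domain_of_exists (T := T) y ⟨_, h⟩
  have hyT := LinearPMap.adjoint_apply_eq hT.dense_domain ⟨y, hya⟩ h
  -- The equality of `T` with its adjoint cannot be rewritten inside the domain proof, so it is
  -- applied to a variable `S`.
  have e : ∀ S : H →ₗ.[ℂ] H, S = T → ∀ hS : y ∈ S.domain, S ⟨y, hS⟩ = w →
      ∃ hyd : y ∈ T.domain, T ⟨y, hyd⟩ = w := by
    rintro S rfl hS h
    exact ⟨hS, h⟩
  exact e _ (LinearPMap.isSelfAdjoint_def.mp hT) hya hyT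

/-- A point `z` at which both `z - T` and its adjoint are bounded below belongs to the resolvent
set. -/
theorem mem_resolventSet_of_bound {T : H →ₗ.[ℂ] H} (hT : IsSelfAdjoint T) {z : ℂ} {C : ℝ}
    (h1 : ∀ u : T.domain, ‖(u : H)‖ ≤ C * ‖subOp T z u‖)
    (h2 : ∀ u : T.domain, subOp T (starRingEnd ℂ z) u = 0 → (u : H) = 0) :
    z ∈ resolventSet T := by
  have hinj : Function.Injective (subOp T z) := by
    rw [← LinearMap.ker_eq_bot, LinearMap.ker_eq_bot']
    intro u hu
    have := h1 u
    rw [hu, norm_zero, mul_zero] at this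
    exact Subtype.ext (norm_le_zero_iff.mp this)
  have h1' : ∀ u : T.domain, ‖(u : H)‖ ≤ |C| * ‖subOp T z u‖ := fun u =>
    (h1 u).trans (mul_le_mul_of_nonneg_right (le_abs_self C) (norm_nonneg _))
  have hT' : ∀ u : T.domain, ‖T u‖ ≤ (‖z‖ * |C| + 1) * ‖subOp T z u‖ := fun u => by
    have e : T u = z • (u : H) - subOp T z u := by rw [subOp_apply]; abel
    calc ‖T u‖ ≤ ‖z • (u : H)‖ + ‖subOp T z u‖ := by rw [e]; exact norm_sub_le _ _
      _ ≤ ‖z‖ * (|C| * ‖subOp T z u‖) + ‖subOp T z u‖ := by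
        rw [norm_smul]; gcongr; exact h1' u
      _ = _ := by ring
  have hclosed : IsClosed (LinearMap.range (subOp T z) : Set H) := by
    have hg : IsClosed (T.graph : Set (H × H)) := hT.isClosed
    have : CompleteSpace T.graph := hg.completeSpace_coe
    -- On the graph, which is complete, `z - T` becomes a bounded operator that is bounded below, so
    -- its range is closed.
    let Φ : T.graph →L[ℂ] H :=
      (z • ContinuousLinearMap.fst ℂ H H - ContinuousLinearMap.snd ℂ H H).comp
        T.graph.subtypeL
    have hΦ : ∀ x : T.graph,
        ‖x‖ ≤ (Real.toNNReal (max |C| (‖z‖ * |C| + 1))) * ‖Φ x‖ := by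
      rintro ⟨x, hx⟩
      obtain ⟨u, rfl⟩ := (LinearPMap.mem_graph_iff' T).mp hx
      rw [Real.coe_toNNReal _ (le_max_of_le_left (abs_nonneg C))]
      exact max_le ((h1' u).trans (mul_le_mul_of_nonneg_right (le_max_left _ _) (norm_nonneg _)))
        ((hT' u).trans (mul_le_mul_of_nonneg_right (le_max_right _ _) (norm_nonneg _)))
    have hc := (ContinuousLinearMap.antilipschitz_of_bound Φ hΦ).isClosed_range
      Φ.uniformContinuous
    convert hc using 1
    ext v
    constructor
    · rintro ⟨u, rfl⟩
      exact ⟨⟨(u, T u), T.mem_graph u⟩, rfl⟩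
    · rintro ⟨⟨x, hx⟩, rfl⟩
      obtain ⟨u, rfl⟩ := (LinearPMap.mem_graph_iff' T).mp hx
      exact ⟨u, rfl⟩
  have hperp : (LinearMap.range (subOp T z))ᗮ = ⊥ := by
    rw [Submodule.eq_bot_iff]
    intro y hy
    -- A vector `y` orthogonal to the range lies in the domain of the adjoint, which is `T`, with `T
    -- y = conj z • y`; `h2` then gives `y = 0`.
    obtain ⟨hyd, hyT⟩ := exists_mem_domain_of_inner hT (y := y) (w := (starRingEnd ℂ z) • y)
      fun u => by
        have := (Submodule.mem_orthogonal' _ _).mp hy _ ⟨u, rfl⟩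
        rw [subOp_apply, inner_sub_right, inner_smul_right, sub_eq_zero] at this
        rw [← this, inner_smul_left, Complex.conj_conj]
    exact h2 ⟨y, hyd⟩ (by rw [subOp_apply, hyT, sub_self])
  have hsurj : Function.Surjective (subOp T z) := by
    have : CompleteSpace (LinearMap.range (subOp T z)) := hclosed.completeSpace_coe
    rw [← LinearMap.range_eq_top]
    exact (Submodule.orthogonal_eq_bot_iff).mp hperp
  refine ⟨⟨hinj, hsurj⟩, ?_⟩
  let e := LinearEquiv.ofBijective (subOp T z) ⟨hinj, hsurj⟩
  refine ⟨(T.domain.subtype ∘ₗ e.symm.toLinearMap).mkContinuous C fun v => ?_, fun u => ?_⟩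
  · calc ‖((e.symm v : T.domain) : H)‖ ≤ C * ‖e (e.symm v)‖ := h1 (e.symm v)
      _ = C * ‖v‖ := by rw [e.apply_symm_apply]
  · change ((e.symm (e u) : T.domain) : H) = u
    rw [e.symm_apply_apply]

/-- Since `⟨u, T u⟩` is real, `⟨u, (z - T) u⟩` has imaginary part `Im z ‖u‖²`; Cauchy–Schwarz does
the rest. -/
theorem abs_im_mul_norm_le {T : H →ₗ.[ℂ] H} (hT : IsSelfAdjoint T) (z : ℂ) (u : T.domain) :
    |z.im| * ‖(u : H)‖ ≤ ‖subOp T z u‖ := by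
  have him : (inner ℂ (u : H) (T u)).im = 0 := by
    have h := inner_conj_symm (𝕜 := ℂ) (u : H) (T u)
    rw [inner_map_eq hT] at h
    exact Complex.conj_eq_iff_im.mp h
  have hi : (inner ℂ (u : H) (subOp T z u)).im = z.im * ‖(u : H)‖ ^ 2 := by
    rw [subOp_apply, inner_sub_right, inner_smul_right, Complex.sub_im, him, sub_zero,
      inner_self_eq_norm_sq_to_K, Complex.mul_im, RCLike.ofReal_eq_complex_ofReal,
      ← Complex.ofReal_pow, Complex.ofReal_re, Complex.ofReal_im, mul_zero, zero_add]
  rcases (norm_nonneg (u : H)).eq_or_lt with h0 | h0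
  · rw [← h0, mul_zero]; exact norm_nonneg _
  · refine le_of_mul_le_mul_left ?_ h0
    calc ‖(u : H)‖ * (|z.im| * ‖(u : H)‖) = |(inner ℂ (u : H) (subOp T z u)).im| := by
          rw [hi, abs_mul, abs_of_nonneg (sq_nonneg ‖(u : H)‖)]; ring
      _ ≤ ‖inner ℂ (u : H) (subOp T z u)‖ := Complex.abs_im_le_norm _
      _ ≤ _ := norm_inner_le_norm _ _

theorem mem_resolventSet_of_im_ne_zero {T : H →ₗ.[ℂ] H} (hT : IsSelfAdjoint T) {z : ℂ}
    (hz : z.im ≠ 0) : z ∈ resolventSet T := by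
  have hz' : 0 < |z.im| := abs_pos.mpr hz
  refine mem_resolventSet_of_bound hT (C := |z.im|⁻¹) (fun u => ?_) fun u hu => ?_
  · rw [inv_mul_eq_div, le_div_iff₀ hz', mul_comm]
    exact abs_im_mul_norm_le hT z u
  · have := abs_im_mul_norm_le hT (starRingEnd ℂ z) u
    rw [hu, norm_zero, Complex.conj_im, abs_neg] at this
    exact norm_le_zero_iff.mp (nonpos_of_mul_nonpos_right this hz')

theorem star_resolventOp {T : H →ₗ.[ℂ] H} (hT : IsSelfAdjoint T) {z : ℂ}
    (hz : z ∈ resolventSet T) (hz' : starRingEnd ℂ z ∈ resolventSet T) :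
    star (resolventOp T z) = resolventOp T (starRingEnd ℂ z) := by
  rw [ContinuousLinearMap.star_eq_adjoint]
  symm
  rw [ContinuousLinearMap.eq_adjoint_iff]
  intro x y
  obtain ⟨u, hu, rfl⟩ := exists_resolventOp_eq hz' x
  obtain ⟨v, hv, rfl⟩ := exists_resolventOp_eq hz y
  rw [hu, hv, inner_subOp_eq hT]

/-- Normality is what makes the continuous functional calculus available for `(-i - T)⁻¹`. -/
theorem isStarNormal_resolventOp {T : H →ₗ.[ℂ] H} (hT : IsSelfAdjoint T) {z : ℂ}
    (hz : z ∈ resolventSet T) (hz' : starRingEnd ℂ z ∈ resolventSet T) :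
    IsStarNormal (resolventOp T z) :=
  ⟨by rw [star_resolventOp hT hz hz']; exact commute_resolventOp hz' hz⟩

end Selfadjoint

end

noncomputable section

variable {H : Type*} [NormedAddCommGroup H] [InnerProductSpace ℂ H]

/-! ### Eigenvectors and continuity of the resolvent. -/

section Eigenvectors

theorem mem_eigenspace_iff {T : H →ₗ.[ℂ] H} {z : ℂ} {v : H} :
    v ∈ eigenspace T z ↔ ∃ hv : v ∈ T.domain, T ⟨v, hv⟩ = z • v := by
  simp only [eigenspace, Submodule.mem_map, LinearMap.mem_ker, subOp_apply]
  constructor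
  · rintro ⟨u, hu, rfl⟩
    exact ⟨u.2, (sub_eq_zero.mp hu).symm⟩
  · rintro ⟨hv, h⟩
    exact ⟨⟨v, hv⟩, by rw [h, sub_self], rfl⟩

theorem eigenspace_eq_bot {T : H →ₗ.[ℂ] H} {z : ℂ} (hz : z ∈ resolventSet T) :
    eigenspace T z = ⊥ := by
  rw [eigenspace, LinearMap.ker_eq_bot.mpr hz.1.1, Submodule.map_bot]

theorem resolventOp_apply_of_mem_eigenspace {T : H →ₗ.[ℂ] H} {z μ : ℂ} {v : H}
    (hz : z ∈ resolventSet T) (hv : v ∈ eigenspace T μ) :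
    resolventOp T z v = (z - μ)⁻¹ • v := by
  -- For `z = μ` the eigenspace is zero, so the value `0⁻¹ = 0` does no harm.
  rcases eq_or_ne z μ with rfl | hne
  · rw [eigenspace_eq_bot hz, Submodule.mem_bot] at hv
    rw [hv, map_zero, smul_zero]
  · obtain ⟨hvd, hTv⟩ := mem_eigenspace_iff.mp hv
    have h := resolventOp_subOp hz ⟨v, hvd⟩
    have e : subOp T z ⟨v, hvd⟩ = (z - μ) • v := by rw [subOp_apply, hTv, sub_smul]
    rw [e, map_smul] at h
    rw [eq_inv_smul_iff₀ (sub_ne_zero.mpr hne)]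
    exact h

end Eigenvectors

/-- The resolvent depends continuously on the operator, in terms of its resolvent at `-i`, and on
the point of the resolvent set. -/
theorem continuous_resolventOp [CompleteSpace H] {X : Type*} [TopologicalSpace X]
    {A : X → H →ₗ.[ℂ] H}
    (hA : ∀ x, -Complex.I ∈ resolventSet (A x))
    (hc : Continuous fun x => resolventOp (A x) (-Complex.I)) {φ : X → ℂ} (hφ : Continuous φ)
    (hm : ∀ x, φ x ∈ resolventSet (A x)) : Continuous fun x => resolventOp (A x) (φ x) := by
  have hp : Continuous fun x => pencil (A x) (φ x) := by
    unfold pencil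
    fun_prop
  have hi : Continuous fun x => Ring.inverse (pencil (A x) (φ x)) := by
    rw [continuous_iff_continuousAt]
    intro x
    obtain ⟨V, hV⟩ := (mem_resolventSet_iff_isUnit (hA x) _).mp (hm x)
    have h := NormedRing.inverse_continuousAt V
    rw [hV] at h
    exact ContinuousAt.comp (f := fun x => pencil (A x) (φ x)) h hp.continuousAt
  have e : (fun x => resolventOp (A x) (φ x)) =
      fun x => resolventOp (A x) (-Complex.I) * Ring.inverse (pencil (A x) (φ x)) :=
    funext fun x => resolventOp_eq_mul_inverse (hA x) (hm x)
  rw [e]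
  exact hc.mul hi

/-! ### Contour integrals and the symbol of the spectral projection. -/

theorem circleIntegral_sub_inv_of_mem_Ioo {c d μ : ℝ} (h : μ ∈ Set.Ioo c d) :
    (∮ z in C((((c + d) / 2 : ℝ) : ℂ), (d - c) / 2), (z - (μ : ℂ))⁻¹) =
      2 * (Real.pi : ℂ) * Complex.I := by
  refine circleIntegral.integral_sub_inv_of_mem_ball ?_
  rw [Metric.mem_ball, Complex.dist_of_im_eq (by simp)]
  simp only [Complex.ofReal_re]
  rw [Real.dist_eq, abs_lt]
  constructor <;> linarith [h.1, h.2]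

theorem circleIntegral_sub_inv_of_notMem_Icc {c d μ : ℝ} (hcd : c ≤ d) (h : μ ∉ Set.Icc c d) :
    (∮ z in C((((c + d) / 2 : ℝ) : ℂ), (d - c) / 2), (z - (μ : ℂ))⁻¹) = 0 := by
  have hne : ∀ z ∈ Metric.closedBall (((c + d) / 2 : ℝ) : ℂ) ((d - c) / 2),
      z - (μ : ℂ) ≠ 0 := by
    intro z hz h0
    rw [sub_eq_zero.mp h0, Metric.mem_closedBall, Complex.dist_of_im_eq (by simp)] at hz
    simp only [Complex.ofReal_re] at hz
    rw [Real.dist_eq, abs_le] at hz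
    exact h ⟨by linarith [hz.1], by linarith [hz.2]⟩
  refine Complex.circleIntegral_eq_zero_of_differentiable_on_off_countable (by linarith)
    Set.countable_empty ?_ fun z hz => ?_
  · exact ContinuousOn.inv₀ (by fun_prop) hne
  · exact DifferentiableAt.inv (by fun_prop) (hne z (Metric.ball_subset_closedBall hz.1))

/-- The function of `(-i - T)⁻¹` that is given by the contour integral of the resolvent of `T`
around `[c, d]`. -/
def spectralSymbol (c d : ℝ) (g : ℂ) : ℂ :=
  (2 * (Real.pi : ℂ) * Complex.I)⁻¹ *
    ∮ z in C((((c + d) / 2 : ℝ) : ℂ), (d - c) / 2), g / (1 + (z + Complex.I) * g)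

theorem neg_I_sub_ofReal_ne_zero (μ : ℝ) : -Complex.I - (μ : ℂ) ≠ 0 := fun h => by
  simpa using congrArg Complex.im h

/-- The point `g = (-i - μ)⁻¹` represents the spectral value `μ`, and at this point the integrand of
the symbol is the Cauchy kernel. -/
theorem div_one_add_eq (z : ℂ) (μ : ℝ) :
    (-Complex.I - (μ : ℂ))⁻¹ / (1 + (z + Complex.I) * (-Complex.I - (μ : ℂ))⁻¹) =
      (z - μ)⁻¹ := by
  have h := neg_I_sub_ofReal_ne_zero μ
  have e : 1 + (z + Complex.I) * (-Complex.I - (μ : ℂ))⁻¹ =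
      (z - μ) * (-Complex.I - (μ : ℂ))⁻¹ := by
    field_simp
    ring
  rw [e, div_eq_mul_inv, mul_inv, inv_inv, mul_left_comm, inv_mul_cancel₀ h, mul_one]

theorem spectralSymbol_zero (c d : ℝ) : spectralSymbol c d 0 = 0 := by
  simp [spectralSymbol, circleIntegral]

theorem spectralSymbol_of_mem_Ioo {c d μ : ℝ} (h : μ ∈ Set.Ioo c d) :
    spectralSymbol c d (-Complex.I - (μ : ℂ))⁻¹ = 1 := by
  simp only [spectralSymbol, div_one_add_eq]
  rw [circleIntegral_sub_inv_of_mem_Ioo h, inv_mul_cancel₀ Complex.two_pi_I_ne_zero]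

theorem spectralSymbol_of_notMem_Icc {c d μ : ℝ} (hcd : c ≤ d) (h : μ ∉ Set.Icc c d) :
    spectralSymbol c d (-Complex.I - (μ : ℂ))⁻¹ = 0 := by
  simp only [spectralSymbol, div_one_add_eq]
  rw [circleIntegral_sub_inv_of_notMem_Icc hcd h, mul_zero]

/-- If the expression vanished, then `g = -(z + i)⁻¹` and `g - R` would be a nonzero multiple of the
invertible pencil, so `g` would not be spectral. -/
theorem one_add_mul_ne_zero {T : H →ₗ.[ℂ] H} (hT : -Complex.I ∈ resolventSet T) {z : ℂ}
    (hz : z ∈ resolventSet T) {g : ℂ} (hg : g ∈ spectrum ℂ (resolventOp T (-Complex.I))) :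
    1 + (z + Complex.I) * g ≠ 0 := by
  intro h0
  have hw : z + Complex.I ≠ 0 := by
    intro h
    rw [h, zero_mul, add_zero] at h0
    exact one_ne_zero h0
  apply hg
  have hu := (mem_resolventSet_iff_isUnit hT z).mp hz
  have e : algebraMap ℂ (H →L[ℂ] H) g - resolventOp T (-Complex.I) =
      (Units.mk0 _ (neg_ne_zero.mpr (inv_ne_zero hw))) • pencil T z := by
    have hg' : g = -(z + Complex.I)⁻¹ := by
      field_simp
      linear_combination h0
    rw [Units.smul_mk0, pencil, smul_add, smul_smul, neg_mul, inv_mul_cancel₀ hw,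
      Algebra.algebraMap_eq_smul_one, hg', neg_one_smul, ← sub_eq_add_neg]
  rw [spectrum.mem_resolventSet_iff, e]
  exact hu.smul _

variable [CompleteSpace H]

/-! ### Functional calculus for spectral projections. -/

/-- For `g ≠ 0` the point `z = -i - g⁻¹` solves `1 + (z + i) g = 0`, hence is outside the resolvent
set, hence is real. The value `g = 0` corresponds to the point at infinity. -/
theorem mem_spectrum_cases {T : H →ₗ.[ℂ] H} (hT : IsSelfAdjoint T) {g : ℂ}
    (hg : g ∈ spectrum ℂ (resolventOp T (-Complex.I))) :
    g = 0 ∨ ∃ μ : ℝ, (μ : ℂ) ∉ resolventSet T ∧ g = (-Complex.I - (μ : ℂ))⁻¹ := by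
  rcases eq_or_ne g 0 with h0 | h0
  · exact Or.inl h0
  · right
    have hn : -Complex.I - g⁻¹ ∉ resolventSet T := fun h =>
      one_add_mul_ne_zero (neg_I_mem_resolventSet hT) h hg (by field_simp; ring)
    have him : (-Complex.I - g⁻¹).im = 0 := by
      by_contra h
      exact hn (mem_resolventSet_of_im_ne_zero hT h)
    have e : (((-Complex.I - g⁻¹).re : ℝ) : ℂ) = -Complex.I - g⁻¹ :=
      Complex.ext (by simp) (by rw [him, Complex.ofReal_im])
    refine ⟨(-Complex.I - g⁻¹).re, by rwa [e], ?_⟩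
    rw [e, sub_sub_cancel, inv_inv]

/-- The circle meets the real axis only at `c` and `d`, and nonreal points always lie in the
resolvent set. -/
theorem circleMap_mem_resolventSet {T : H →ₗ.[ℂ] H} (hT : IsSelfAdjoint T) {c d : ℝ}
    (hc : (c : ℂ) ∈ resolventSet T) (hd : (d : ℂ) ∈ resolventSet T) (θ : ℝ) :
    circleMap (((c + d) / 2 : ℝ) : ℂ) ((d - c) / 2) θ ∈ resolventSet T := by
  set z := circleMap (((c + d) / 2 : ℝ) : ℂ) ((d - c) / 2) θ with hz
  by_cases him : z.im = 0
  · have h1 : dist z (((c + d) / 2 : ℝ) : ℂ) = |(d - c) / 2| := by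
      rw [hz, dist_eq_norm, circleMap_sub_center, norm_circleMap_zero]
    rw [Complex.dist_of_im_eq (by simpa using him), Complex.ofReal_re, Real.dist_eq,
      abs_eq_abs] at h1
    rcases h1 with h1 | h1
    · have : z = (d : ℂ) := Complex.ext (by rw [Complex.ofReal_re]; linarith) (by simpa using him)
      rwa [this]
    · have : z = (c : ℂ) := Complex.ext (by rw [Complex.ofReal_re]; linarith) (by simpa using him)
      rwa [this]
  · exact mem_resolventSet_of_im_ne_zero hT him

theorem continuous_resolventOp_circleMap {T : H →ₗ.[ℂ] H} (hT : IsSelfAdjoint T) {c d : ℝ}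
    (hc : (c : ℂ) ∈ resolventSet T) (hd : (d : ℂ) ∈ resolventSet T) :
    Continuous fun θ : ℝ =>
      resolventOp T (circleMap (((c + d) / 2 : ℝ) : ℂ) ((d - c) / 2) θ) :=
  continuous_resolventOp (fun _ => neg_I_mem_resolventSet hT) continuous_const (by fun_prop)
    (circleMap_mem_resolventSet hT hc hd)

theorem spectralProjection_apply {T : H →ₗ.[ℂ] H} (hT : IsSelfAdjoint T) {c d : ℝ}
    (hc : (c : ℂ) ∈ resolventSet T) (hd : (d : ℂ) ∈ resolventSet T) (v : H) :
    spectralProjection T c d v = (2 * (Real.pi : ℂ) * Complex.I)⁻¹ •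
      ∮ z in C((((c + d) / 2 : ℝ) : ℂ), (d - c) / 2), resolventOp T z v := by
  rw [spectralProjection, smul_apply]
  congr 1
  simp only [circleIntegral]
  rw [ContinuousLinearMap.intervalIntegral_apply]
  · rfl
  · refine Continuous.intervalIntegrable ?_ _ _
    simp only [deriv_circleMap]
    exact ((continuous_circleMap 0 _).mul continuous_const).smul
      (continuous_resolventOp_circleMap hT hc hd)

theorem spectralProjection_apply_of_mem_eigenspace {T : H →ₗ.[ℂ] H} (hT : IsSelfAdjoint T)
    {c d : ℝ} (hc : (c : ℂ) ∈ resolventSet T) (hd : (d : ℂ) ∈ resolventSet T) {μ : ℂ} {v : H}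
    (hv : v ∈ eigenspace T μ) :
    spectralProjection T c d v = ((2 * (Real.pi : ℂ) * Complex.I)⁻¹ *
      ∮ z in C((((c + d) / 2 : ℝ) : ℂ), (d - c) / 2), (z - μ)⁻¹) • v := by
  rw [spectralProjection_apply hT hc hd, mul_smul, ← circleIntegral.integral_smul_const]
  congr 1
  simp only [circleIntegral]
  congr 1
  funext θ
  rw [resolventOp_apply_of_mem_eigenspace (circleMap_mem_resolventSet hT hc hd θ) hv]

theorem spectralProjection_apply_of_mem_Ioo {T : H →ₗ.[ℂ] H} (hT : IsSelfAdjoint T)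
    {c d : ℝ} (hc : (c : ℂ) ∈ resolventSet T) (hd : (d : ℂ) ∈ resolventSet T) {μ : ℝ}
    (hμ : μ ∈ Set.Ioo c d) {v : H} (hv : v ∈ eigenspace T μ) :
    spectralProjection T c d v = v := by
  rw [spectralProjection_apply_of_mem_eigenspace hT hc hd hv,
    circleIntegral_sub_inv_of_mem_Ioo hμ, inv_mul_cancel₀ Complex.two_pi_I_ne_zero, one_smul]

theorem spectralProjection_apply_of_mem_Icc {T : H →ₗ.[ℂ] H} (hT : IsSelfAdjoint T)
    {c d : ℝ} (hc : (c : ℂ) ∈ resolventSet T) (hd : (d : ℂ) ∈ resolventSet T) {μ : ℝ}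
    (hμ : μ ∈ Set.Icc c d) {v : H} (hv : v ∈ eigenspace T μ) :
    spectralProjection T c d v = v := by
  by_cases hρ : (μ : ℂ) ∈ resolventSet T
  · rw [eigenspace_eq_bot hρ, Submodule.mem_bot] at hv
    rw [hv, map_zero]
  · refine spectralProjection_apply_of_mem_Ioo hT hc hd
      ⟨lt_of_le_of_ne hμ.1 ?_, lt_of_le_of_ne hμ.2 ?_⟩ hv
    · rintro rfl; exact hρ hc
    · rintro rfl; exact hρ hd

theorem spectralProjection_apply_of_notMem_Icc {T : H →ₗ.[ℂ] H} (hT : IsSelfAdjoint T)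
    {c d : ℝ} (hcd : c ≤ d) (hc : (c : ℂ) ∈ resolventSet T) (hd : (d : ℂ) ∈ resolventSet T)
    {μ : ℝ} (hμ : μ ∉ Set.Icc c d) {v : H} (hv : v ∈ eigenspace T μ) :
    spectralProjection T c d v = 0 := by
  rw [spectralProjection_apply_of_mem_eigenspace hT hc hd hv,
    circleIntegral_sub_inv_of_notMem_Icc hcd hμ, mul_zero, zero_smul]

theorem eigenspaceSum_le_eqLocus {T : H →ₗ.[ℂ] H} (hT : IsSelfAdjoint T)
    {c d : ℝ} (hc : (c : ℂ) ∈ resolventSet T) (hd : (d : ℂ) ∈ resolventSet T) :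
    eigenspaceSum T c d ≤
      LinearMap.eqLocus (spectralProjection T c d).toLinearMap LinearMap.id :=
  iSup₂_le fun _ hμ _ hv => spectralProjection_apply_of_mem_Icc hT hc hd hμ hv

theorem eigenspaceSum_le_range {T : H →ₗ.[ℂ] H} (hT : IsSelfAdjoint T)
    {c d : ℝ} (hc : (c : ℂ) ∈ resolventSet T) (hd : (d : ℂ) ∈ resolventSet T) :
    eigenspaceSum T c d ≤ LinearMap.range (spectralProjection T c d).toLinearMap :=
  fun v hv => ⟨v, eigenspaceSum_le_eqLocus hT hc hd hv⟩

theorem continuousOn_kernel {T : H →ₗ.[ℂ] H} (hT : IsSelfAdjoint T) {c d : ℝ}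
    (hc : (c : ℂ) ∈ resolventSet T) (hd : (d : ℂ) ∈ resolventSet T) :
    ContinuousOn (Function.uncurry fun (θ : ℝ) (g : ℂ) =>
      deriv (circleMap (((c + d) / 2 : ℝ) : ℂ) ((d - c) / 2)) θ •
        (g / (1 + (circleMap (((c + d) / 2 : ℝ) : ℂ) ((d - c) / 2) θ + Complex.I) * g)))
      (Set.univ ×ˢ spectrum ℂ (resolventOp T (-Complex.I))) := by
  simp only [deriv_circleMap, Function.uncurry_def]
  have h1 : Continuous fun p : ℝ × ℂ => circleMap 0 ((d - c) / 2) p.1 * Complex.I := by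
    fun_prop
  have h2 : Continuous fun p : ℝ × ℂ =>
      1 + (circleMap (((c + d) / 2 : ℝ) : ℂ) ((d - c) / 2) p.1 + Complex.I) * p.2 := by
    fun_prop
  exact h1.continuousOn.smul (continuousOn_snd.div h2.continuousOn fun p hp =>
    one_add_mul_ne_zero (neg_I_mem_resolventSet hT) (circleMap_mem_resolventSet hT hc hd p.1) hp.2)

theorem continuousOn_spectralSymbol {T : H →ₗ.[ℂ] H} (hT : IsSelfAdjoint T) {c d : ℝ}
    (hc : (c : ℂ) ∈ resolventSet T) (hd : (d : ℂ) ∈ resolventSet T) :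
    ContinuousOn (spectralSymbol c d) (spectrum ℂ (resolventOp T (-Complex.I))) := by
  unfold spectralSymbol
  refine ContinuousOn.mul continuousOn_const ?_
  simp only [circleIntegral]
  rw [continuousOn_iff_continuous_domRestrict]
  refine intervalIntegral.continuous_parametric_intervalIntegral_of_continuous' ?_ _ _
  exact (continuousOn_kernel hT hc hd).comp_continuous
    (f := fun p : spectrum ℂ (resolventOp T (-Complex.I)) × ℝ => (p.2, (p.1 : ℂ)))
    (by fun_prop) (fun p => ⟨Set.mem_univ _, p.1.2⟩)

/-- The resolvents of a selfadjoint operator are functions of its resolvent at `-i`. -/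
theorem resolventOp_eq_cfc {T : H →ₗ.[ℂ] H} (hT : IsSelfAdjoint T) {z : ℂ}
    (hz : z ∈ resolventSet T) :
    resolventOp T z =
      cfc (fun g => g / (1 + (z + Complex.I) * g)) (resolventOp T (-Complex.I)) := by
  have hI := neg_I_mem_resolventSet hT
  have hN : IsStarNormal (resolventOp T (-Complex.I)) :=
    isStarNormal_resolventOp hT hI (mem_resolventSet_of_im_ne_zero hT (by simp))
  rw [cfc_map_div (fun g => g) (fun g => 1 + (z + Complex.I) * g) _
    (fun g hg => one_add_mul_ne_zero hI hz hg), cfc_id' ℂ _, resolventOp_eq_mul_inverse hI hz]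
  congr 2
  rw [cfc_add _ (fun _ => 1) (fun g => (z + Complex.I) * g),
    cfc_const_mul (z + Complex.I) (fun g => g), cfc_id' ℂ _, cfc_const_one ℂ _, pencil]

/-- The functional calculus commutes with integration over the angle; joint continuity of the kernel
on the compact set `[0, 2π] × spectrum` provides the dominating constant. -/
theorem spectralProjection_eq_cfc {T : H →ₗ.[ℂ] H} (hT : IsSelfAdjoint T) {c d : ℝ}
    (hc : (c : ℂ) ∈ resolventSet T) (hd : (d : ℂ) ∈ resolventSet T) :
    spectralProjection T c d = cfc (spectralSymbol c d) (resolventOp T (-Complex.I)) := by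
  have hI := neg_I_mem_resolventSet hT
  have hN : IsStarNormal (resolventOp T (-Complex.I)) :=
    isStarNormal_resolventOp hT hI (mem_resolventSet_of_im_ne_zero hT (by simp))
  have hk := continuousOn_kernel hT hc hd
  have hcont : ContinuousOn (fun g => ∮ z in C((((c + d) / 2 : ℝ) : ℂ), (d - c) / 2),
      g / (1 + (z + Complex.I) * g)) (spectrum ℂ (resolventOp T (-Complex.I))) := by
    have := (continuousOn_spectralSymbol hT hc hd).const_smul (2 * (Real.pi : ℂ) * Complex.I)
    exact this.congr fun g _ => (mul_inv_cancel_left₀ Complex.two_pi_I_ne_zero _).symm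
  have e : spectralSymbol c d = fun g => (2 * (Real.pi : ℂ) * Complex.I)⁻¹ *
    ∮ z in C((((c + d) / 2 : ℝ) : ℂ), (d - c) / 2), g / (1 + (z + Complex.I) * g) := rfl
  rw [e, cfc_const_mul _ _ _ hcont, spectralProjection]
  congr 1
  simp only [circleIntegral]
  simp only [intervalIntegral.integral_of_le Real.two_pi_pos.le]
  obtain ⟨C, hC⟩ := ((isCompact_Icc (a := (0 : ℝ)) (b := 2 * Real.pi)).prod
    (spectrum.isCompact (𝕜 := ℂ) (resolventOp T (-Complex.I)))).exists_bound_of_continuousOn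
    (hk.mono (Set.prod_mono (Set.subset_univ _) le_rfl))
  rw [cfc_setIntegral measurableSet_Ioc _ (fun _ => C) _
    (hk.mono (Set.prod_mono (Set.subset_univ _) le_rfl))]
  · congr 1
    funext θ
    have hm := circleMap_mem_resolventSet hT hc hd θ
    rw [resolventOp_eq_cfc hT hm, ← cfc_smul _ _ _ ?_]
    refine ContinuousOn.div (by fun_prop) (by fun_prop) fun g hg => ?_
    exact one_add_mul_ne_zero hI hm hg
  · filter_upwards [MeasureTheory.ae_restrict_mem measurableSet_Ioc] with θ hθ g hg
    exact hC (θ, g) ⟨Set.Ioc_subset_Icc_self hθ, hg⟩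
  · exact MeasureTheory.hasFiniteIntegral_const _

theorem spectralSymbol_cases {T : H →ₗ.[ℂ] H} (hT : IsSelfAdjoint T) {c d : ℝ} (hcd : c ≤ d)
    (hc : (c : ℂ) ∈ resolventSet T) (hd : (d : ℂ) ∈ resolventSet T) {g : ℂ}
    (hg : g ∈ spectrum ℂ (resolventOp T (-Complex.I))) :
    spectralSymbol c d g = 0 ∨ spectralSymbol c d g = 1 ∧
      ∃ μ ∈ Set.Ioo c d, (μ : ℂ) ∉ resolventSet T ∧ g = (-Complex.I - (μ : ℂ))⁻¹ := by
  rcases mem_spectrum_cases hT hg with rfl | ⟨μ, hμ, rfl⟩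
  · exact Or.inl (spectralSymbol_zero c d)
  · by_cases h : μ ∈ Set.Icc c d
    · have h' : μ ∈ Set.Ioo c d := by
        refine ⟨lt_of_le_of_ne h.1 ?_, lt_of_le_of_ne h.2 ?_⟩
        · rintro rfl; exact hμ hc
        · rintro rfl; exact hμ hd
      exact Or.inr ⟨spectralSymbol_of_mem_Ioo h', μ, h', hμ, rfl⟩
    · exact Or.inl (spectralSymbol_of_notMem_Icc hcd h)

/-- Spectral projections are monotone: `χ_{[c',d']}(T) χ_{[c,d]}(T) = χ_{[c,d]}(T)` if `[c,d]` is
contained in `[c',d']`. -/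
theorem spectralProjection_mul_of_subset {T : H →ₗ.[ℂ] H} (hT : IsSelfAdjoint T) {c d c' d' : ℝ}
    (hcd : c ≤ d) (hc : (c : ℂ) ∈ resolventSet T) (hd : (d : ℂ) ∈ resolventSet T)
    (hc' : (c' : ℂ) ∈ resolventSet T) (hd' : (d' : ℂ) ∈ resolventSet T)
    (hcc' : c' ≤ c) (hdd' : d ≤ d') :
    spectralProjection T c' d' * spectralProjection T c d = spectralProjection T c d := by
  rw [spectralProjection_eq_cfc hT hc hd, spectralProjection_eq_cfc hT hc' hd',
    ← cfc_mul _ _ _ (continuousOn_spectralSymbol hT hc' hd')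
      (continuousOn_spectralSymbol hT hc hd)]
  refine cfc_congr fun g hg => ?_
  rcases spectralSymbol_cases hT hcd hc hd hg with h | ⟨h, μ, hμ, -, rfl⟩
  · simp only [h, mul_zero]
  · simp only [h, mul_one]
    exact spectralSymbol_of_mem_Ioo ⟨hcc'.trans_lt hμ.1, hμ.2.trans_le hdd'⟩

theorem isIdempotentElem_spectralProjection {T : H →ₗ.[ℂ] H} (hT : IsSelfAdjoint T) {c d : ℝ}
    (hcd : c ≤ d) (hc : (c : ℂ) ∈ resolventSet T) (hd : (d : ℂ) ∈ resolventSet T) :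
    IsIdempotentElem (spectralProjection T c d) :=
  spectralProjection_mul_of_subset hT hcd hc hd hc hd le_rfl le_rfl

theorem range_le_range_of_subset {T : H →ₗ.[ℂ] H} (hT : IsSelfAdjoint T) {c d c' d' : ℝ}
    (hcd : c ≤ d) (hc : (c : ℂ) ∈ resolventSet T) (hd : (d : ℂ) ∈ resolventSet T)
    (hc' : (c' : ℂ) ∈ resolventSet T) (hd' : (d' : ℂ) ∈ resolventSet T)
    (hcc' : c' ≤ c) (hdd' : d ≤ d') :
    LinearMap.range (spectralProjection T c d).toLinearMap ≤
      LinearMap.range (spectralProjection T c' d').toLinearMap := by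
  rintro _ ⟨x, rfl⟩
  refine ⟨spectralProjection T c d x, ?_⟩
  exact DFunLike.congr_fun
    (spectralProjection_mul_of_subset hT hcd hc hd hc' hd' hcc' hdd') x

theorem spectralProjection_apply_of_mem_range {T : H →ₗ.[ℂ] H} (hT : IsSelfAdjoint T) {c d : ℝ}
    (hcd : c ≤ d) (hc : (c : ℂ) ∈ resolventSet T) (hd : (d : ℂ) ∈ resolventSet T) {v : H}
    (hv : v ∈ LinearMap.range (spectralProjection T c d).toLinearMap) :
    spectralProjection T c d v = v := by
  obtain ⟨x, rfl⟩ := hv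
  exact DFunLike.congr_fun (isIdempotentElem_spectralProjection hT hcd hc hd) x

theorem commute_resolventOp_spectralProjection {T : H →ₗ.[ℂ] H} (hT : IsSelfAdjoint T) {c d : ℝ}
    (hc : (c : ℂ) ∈ resolventSet T) (hd : (d : ℂ) ∈ resolventSet T) :
    Commute (resolventOp T (-Complex.I)) (spectralProjection T c d) := by
  have hN : IsStarNormal (resolventOp T (-Complex.I)) :=
    isStarNormal_resolventOp hT (neg_I_mem_resolventSet hT)
      (mem_resolventSet_of_im_ne_zero hT (by simp))
  rw [spectralProjection_eq_cfc hT hc hd]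
  have h := cfc_commute_cfc (fun g : ℂ => g) (spectralSymbol c d)
    (resolventOp T (-Complex.I))
  rwa [cfc_id' ℂ _] at h

/-! ### Finite-rank spectral projections and eigenvectors. -/

/-- A finite-dimensional subspace that is invariant under a resolvent of a selfadjoint operator is
spanned by the eigenvectors that it contains. -/
theorem le_iSup_inf_eigenspace {T : H →ₗ.[ℂ] H} (hT : IsSelfAdjoint T) (V : Submodule ℂ H)
    [FiniteDimensional ℂ V] (hV : ∀ v ∈ V, resolventOp T (-Complex.I) v ∈ V) :
    V ≤ ⨆ μ : ℝ, V ⊓ eigenspace T (μ : ℂ) := by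
  have hI := neg_I_mem_resolventSet hT
  let G : V →ₗ[ℂ] V := (resolventOp T (-Complex.I)).toLinearMap.restrict hV
  have hGinj : Function.Injective G := by
    rw [← LinearMap.ker_eq_bot, LinearMap.ker_eq_bot']
    intro v hv
    obtain ⟨u, hu, huv⟩ := exists_resolventOp_eq hI (v : H)
    have h0 : resolventOp T (-Complex.I) (v : H) = 0 := congrArg Subtype.val hv
    have : u = 0 := Subtype.ext (hu.symm.trans h0)
    rw [this, map_zero] at huv
    exact Subtype.ext huv.symm
  have hmem : ∀ v ∈ V, ∃ hv : v ∈ T.domain, T ⟨v, hv⟩ ∈ V := by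
    intro v hv
    -- An injective endomorphism of a finite-dimensional space is onto, so `V` is the resolvent
    -- image of itself; thus `V` lies in the domain and `T` maps `V` into `V`.
    obtain ⟨w, hw⟩ := (LinearMap.injective_iff_surjective.mp hGinj) ⟨v, hv⟩
    obtain ⟨u, hu, huw⟩ := exists_resolventOp_eq hI (w : H)
    have h0 : resolventOp T (-Complex.I) (w : H) = v := congrArg Subtype.val hw
    have huv : (u : H) = v := hu.symm.trans h0
    subst huv
    refine ⟨u.2, ?_⟩
    have : T u = -Complex.I • (u : H) - w := by rw [← huw, subOp_apply]; abel
    change T u ∈ V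
    rw [this]
    exact V.sub_mem (V.smul_mem _ hv) w.2
  let S : V →ₗ[ℂ] V :=
    (T.toFun ∘ₗ Submodule.inclusion (fun v hv => (hmem v hv).1 : V ≤ T.domain)).codRestrict V
      fun v => (hmem v v.2).2
  have hS : ∀ v : V, ((S v : V) : H) = T ⟨v, (hmem v v.2).1⟩ := fun v => rfl
  have hsymm : S.IsSymmetric := fun u v => by
    rw [Submodule.coe_inner, Submodule.coe_inner, hS, hS]
    exact inner_map_eq hT ⟨u, (hmem u u.2).1⟩ ⟨v, (hmem v v.2).1⟩
  -- The spectral theorem for the symmetric operator that `T` induces on `V`.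
  have htop : (⨆ μ : ℂ, Module.End.eigenspace S μ) = ⊤ :=
    Submodule.orthogonal_eq_bot_iff.mp hsymm.orthogonalComplement_iSup_eigenspaces_eq_bot
  have hVmap : V = (⨆ μ : ℂ, Module.End.eigenspace S μ).map V.subtype := by
    rw [htop, Submodule.map_subtype_top]
  conv_lhs => rw [hVmap]
  rw [Submodule.map_iSup]
  refine iSup_le fun μ => ?_
  rintro _ ⟨v, hv, rfl⟩
  rcases eq_or_ne v 0 with rfl | hv0
  · rw [map_zero]; exact zero_mem _
  have hμ : starRingEnd ℂ μ = μ :=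
    hsymm.conj_eigenvalue_eq_self (Module.End.hasEigenvalue_of_hasEigenvector ⟨hv, hv0⟩)
  rw [Complex.conj_eq_iff_re] at hμ
  refine Submodule.mem_iSup_of_mem μ.re ⟨v.2, mem_eigenspace_iff.mpr ⟨(hmem v v.2).1, ?_⟩⟩
  have h := Module.End.mem_eigenspace_iff.mp hv
  rw [← hμ] at h
  exact congrArg Subtype.val h

/-- The range is invariant under the resolvent, so it is spanned by eigenvectors of `T`. Those with
eigenvalue outside `[c,d]` are both fixed and killed by the projection, hence zero. -/
theorem range_spectralProjection_eq {T : H →ₗ.[ℂ] H} (hT : IsSelfAdjoint T) {c d : ℝ}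
    (hcd : c ≤ d) (hc : (c : ℂ) ∈ resolventSet T) (hd : (d : ℂ) ∈ resolventSet T)
    [FiniteDimensional ℂ (LinearMap.range (spectralProjection T c d).toLinearMap)] :
    LinearMap.range (spectralProjection T c d).toLinearMap = eigenspaceSum T c d := by
  refine le_antisymm ?_ (eigenspaceSum_le_range hT hc hd)
  refine (le_iSup_inf_eigenspace hT _ ?_).trans (iSup_le fun μ v hv => ?_)
  · rintro _ ⟨x, rfl⟩
    exact ⟨resolventOp T (-Complex.I) x, (DFunLike.congr_fun
      (commute_resolventOp_spectralProjection hT hc hd).eq x).symm⟩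
  · by_cases hμ : μ ∈ Set.Icc c d
    · exact Submodule.mem_iSup_of_mem μ (Submodule.mem_iSup_of_mem hμ hv.2)
    · rw [← spectralProjection_apply_of_mem_range hT hcd hc hd hv.1,
        spectralProjection_apply_of_notMem_Icc hT hcd hc hd hμ hv.2]
      exact zero_mem _

end

noncomputable section

/-! ### Ranks of nearby idempotents. -/

section Idempotents

variable {E : Type*} [NormedAddCommGroup E] [NormedSpace ℂ E]

/-- `Q` is injective on the range of `P`: if `P x = x` and `Q x = 0`, then `‖x‖ = ‖(Q - P) x‖ ≤ ‖Q -
P‖ ‖x‖`, which forces `x = 0`. -/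
theorem rank_range_le_of_norm_sub_lt_one {P Q : E →L[ℂ] E} (hP : IsIdempotentElem P)
    (h : ‖Q - P‖ < 1) :
    Module.rank ℂ (LinearMap.range P.toLinearMap) ≤
      Module.rank ℂ (LinearMap.range Q.toLinearMap) := by
  let f : LinearMap.range P.toLinearMap →ₗ[ℂ] LinearMap.range Q.toLinearMap :=
    Q.toLinearMap.rangeRestrict ∘ₗ (LinearMap.range P.toLinearMap).subtype
  refine LinearMap.rank_le_of_injective f ?_
  rw [← LinearMap.ker_eq_bot, LinearMap.ker_eq_bot']
  rintro ⟨_, y, rfl⟩ hx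
  set x : E := P y with hxy
  have hQ : Q x = 0 := congrArg Subtype.val hx
  have hPx : P x = x := DFunLike.congr_fun hP y
  have h1 : ‖x‖ ≤ ‖Q - P‖ * ‖x‖ := by
    calc ‖x‖ = ‖(Q - P) x‖ := by rw [sub_apply, hQ, hPx, zero_sub, norm_neg]
      _ ≤ _ := ContinuousLinearMap.le_opNorm _ _
  have h2 : ‖x‖ = 0 := by
    by_contra h0
    have : 0 < ‖x‖ := lt_of_le_of_ne (norm_nonneg _) (Ne.symm h0)
    nlinarith
  exact Subtype.ext (norm_eq_zero.mp h2)

theorem rank_range_eq_of_norm_sub_lt_one {P Q : E →L[ℂ] E} (hP : IsIdempotentElem P)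
    (hQ : IsIdempotentElem Q) (h : ‖Q - P‖ < 1) :
    Module.rank ℂ (LinearMap.range P.toLinearMap) =
      Module.rank ℂ (LinearMap.range Q.toLinearMap) :=
  le_antisymm (rank_range_le_of_norm_sub_lt_one hP h)
    (rank_range_le_of_norm_sub_lt_one hQ (by rwa [norm_sub_rev]))

theorem finrank_range_eq_of_continuousOn {X : Type*} [TopologicalSpace X] {s : Set X}
    (hs : IsPreconnected s) {P : X → E →L[ℂ] E} (hc : ContinuousOn P s)
    (hP : ∀ x ∈ s, IsIdempotentElem (P x)) {x y : X} (hx : x ∈ s) (hy : y ∈ s) :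
    Module.finrank ℂ (LinearMap.range (P x).toLinearMap) =
      Module.finrank ℂ (LinearMap.range (P y).toLinearMap) := by
  refine hs.constant (f := fun x => Module.finrank ℂ (LinearMap.range (P x).toLinearMap))
    (fun z hz => ?_) hx hy
  refine ContinuousWithinAt.congr_of_eventuallyEq continuousWithinAt_const ?_ rfl
  have h1 := (hc z hz).eventually (Metric.ball_mem_nhds (P z) one_pos)
  filter_upwards [h1, self_mem_nhdsWithin] with w hw hws
  rw [dist_eq_norm] at hw
  rw [Module.finrank, Module.finrank,
    rank_range_eq_of_norm_sub_lt_one (hP z hz) (hP w hws) hw]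

end Idempotents

variable {H : Type*} [NormedAddCommGroup H] [InnerProductSpace ℂ H]

/-! ### Continuity in the gap metric. -/

theorem IsFredholm.finiteDimensional_eigenspace_zero {T : H →ₗ.[ℂ] H} (hT : IsFredholm T) :
    FiniteDimensional ℂ (eigenspace T 0) := by
  have := hT.2.1
  have h : eigenspace T 0 ≤ (LinearMap.ker T.toFun).map T.domain.subtype := by
    intro v hv
    obtain ⟨hvd, hTv⟩ := mem_eigenspace_iff.mp hv
    exact ⟨⟨v, hvd⟩, hTv.trans (zero_smul _ _), rfl⟩
  exact Submodule.finiteDimensional_of_le h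

variable [CompleteSpace H]

theorem CFsa.isSelfAdjoint (T : CFsa H) : IsSelfAdjoint T.op := T.2.1

theorem CFsa.isFredholm (T : CFsa H) : IsFredholm T.op := T.2.2

theorem isometry_cayley : Isometry fun T : CFsa H => cayley T.op :=
  Isometry.of_dist_eq fun _ _ => rfl

theorem continuous_resolventOp_neg_I :
    Continuous fun T : CFsa H => resolventOp T.op (-Complex.I) := by
  have e : (fun T : CFsa H => resolventOp T.op (-Complex.I)) = fun T : CFsa H =>
      (2 * Complex.I)⁻¹ • (cayley T.op - ContinuousLinearMap.id ℂ H) := by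
    funext T
    have h2 : (2 * Complex.I : ℂ) ≠ 0 := by simp
    rw [cayley, smul_neg, sub_neg_eq_add, add_sub_cancel_left, smul_smul, inv_mul_cancel₀ h2,
      one_smul]
  rw [e]
  have := (isometry_cayley (H := H)).continuous
  fun_prop

theorem isOpen_setOf_mem_resolventSet (z : ℂ) : IsOpen {T : CFsa H | z ∈ resolventSet T.op} := by
  have e : {T : CFsa H | z ∈ resolventSet T.op} =
      (fun T : CFsa H => pencil T.op z) ⁻¹' {x | IsUnit x} :=
    Set.ext fun T => mem_resolventSet_iff_isUnit (neg_I_mem_resolventSet T.isSelfAdjoint) z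
  rw [e]
  refine Units.isOpen.preimage ?_
  unfold pencil
  have := continuous_resolventOp_neg_I (H := H)
  fun_prop

theorem continuousOn_spectralProjection (c d : ℝ) :
    ContinuousOn (fun T : CFsa H => spectralProjection T.op c d)
      {T : CFsa H | (c : ℂ) ∈ resolventSet T.op ∧ (d : ℂ) ∈ resolventSet T.op} := by
  rw [continuousOn_iff_continuous_domRestrict]
  refine Continuous.fun_const_smul ?_ _
  refine intervalIntegral.continuous_parametric_intervalIntegral_of_continuous' ?_ _ _
  set S := {T : CFsa H | (c : ℂ) ∈ resolventSet T.op ∧ (d : ℂ) ∈ resolventSet T.op}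
  have h1 : Continuous fun p : S × ℝ =>
      resolventOp p.1.1.op (circleMap (((c + d) / 2 : ℝ) : ℂ) ((d - c) / 2) p.2) :=
    continuous_resolventOp (fun p => neg_I_mem_resolventSet p.1.1.isSelfAdjoint)
      (continuous_resolventOp_neg_I.comp (continuous_subtype_val.comp continuous_fst))
      (by fun_prop) fun p => circleMap_mem_resolventSet p.1.1.isSelfAdjoint p.1.2.1 p.1.2.2 p.2
  have h2 : Continuous fun p : S × ℝ => circleMap 0 ((d - c) / 2) p.2 * Complex.I := by
    fun_prop
  simp only [deriv_circleMap]
  exact h2.smul h1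

/-! ### Isolation of zero in the spectrum of a Fredholm operator. -/

section Fredholm

/-- The range of a Fredholm operator has a bounded right inverse. -/
theorem IsFredholm.exists_bound {T : H →ₗ.[ℂ] H} (hT : IsFredholm T) :
    ∃ C > 0, ∀ u : T.domain, ∃ v : T.domain, T v = T u ∧ ‖(v : H)‖ ≤ C * ‖T u‖ := by
  obtain ⟨hcl, -, hfin⟩ := hT
  have hg : IsClosed (T.graph : Set (H × H)) := hcl
  have : CompleteSpace T.graph := hg.completeSpace_coe
  obtain ⟨W, hW⟩ := Submodule.exists_isCompl (LinearMap.range T.toFun)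
  have : FiniteDimensional ℂ W :=
    (Submodule.quotientEquivOfIsCompl _ W hW).finiteDimensional
  have : CompleteSpace W := FiniteDimensional.complete ℂ W
  -- A finite-dimensional complement `W` of the range makes `Ψ` a surjection of Banach spaces, so
  -- the open mapping theorem yields `C`.
  let Ψ : T.graph × W →L[ℂ] H :=
    ((ContinuousLinearMap.snd ℂ H H).comp T.graph.subtypeL).coprod W.subtypeL
  have hsurj : Function.Surjective Ψ := by
    intro y
    have hy : y ∈ LinearMap.range T.toFun ⊔ W := by rw [hW.sup_eq_top]; trivial
    obtain ⟨_, ⟨u, rfl⟩, w, hw, rfl⟩ := Submodule.mem_sup.mp hy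
    exact ⟨(⟨(u, T u), T.mem_graph u⟩, ⟨w, hw⟩), rfl⟩
  obtain ⟨C, hC0, hC⟩ := Ψ.exists_preimage_norm_le hsurj
  refine ⟨C, hC0, fun u => ?_⟩
  obtain ⟨⟨⟨x, hx⟩, w⟩, h1, h2⟩ := hC (T u)
  obtain ⟨v, rfl⟩ := (LinearPMap.mem_graph_iff' T).mp hx
  have h3 : T v + (w : H) = T u := h1
  have hw0 : (w : H) = 0 := by
    refine (Submodule.disjoint_def.mp hW.disjoint) _ ⟨u - v, ?_⟩ w.2
    rw [map_sub]
    exact sub_eq_of_eq_add' h3.symm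
  refine ⟨v, by rw [← h3, hw0, add_zero], le_trans ?_ h2⟩
  exact (norm_fst_le ((v : H), T v)).trans (le_max_left _ _)

/-- Take the controlled `v` with `T v = T u`. As `u - v` is in the kernel and `u` is orthogonal to
it, `‖u‖² = ⟨u, v⟩ ≤ ‖u‖ ‖v‖`. -/
theorem exists_norm_le_of_mem_orthogonal {T : H →ₗ.[ℂ] H} (hF : IsFredholm T) :
    ∃ C > 0, ∀ u : T.domain, (u : H) ∈ (eigenspace T 0)ᗮ → ‖(u : H)‖ ≤ C * ‖T u‖ := by
  obtain ⟨C, hC0, hC⟩ := hF.exists_bound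
  refine ⟨C, hC0, fun u hu => ?_⟩
  obtain ⟨v, hv, hvC⟩ := hC u
  refine le_trans ?_ hvC
  have hk : (u : H) - v ∈ eigenspace T 0 :=
    mem_eigenspace_iff.mpr ⟨(u - v).2, by
      change T (u - v) = _
      rw [LinearPMap.map_sub, hv, sub_self, zero_smul]⟩
  have h0 := (Submodule.mem_orthogonal' _ _).mp hu _ hk
  rw [inner_sub_right, sub_eq_zero, inner_self_eq_norm_sq_to_K] at h0
  have h1 : ‖(u : H)‖ ^ 2 ≤ ‖(u : H)‖ * ‖(v : H)‖ := by
    calc ‖(u : H)‖ ^ 2 = ‖((‖(u : H)‖ : ℂ)) ^ 2‖ := by simp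
      _ ≤ _ := by
        rw [RCLike.ofReal_eq_complex_ofReal] at h0
        rw [h0]; exact norm_inner_le_norm _ _
  rcases (norm_nonneg (u : H)).eq_or_lt with h | h
  · rw [← h]; exact norm_nonneg _
  · exact le_of_mul_le_mul_left (by rwa [← sq]) h

/-- For a selfadjoint Fredholm operator, `0` is at most an isolated point of the spectrum. -/
theorem exists_forall_mem_resolventSet {T : H →ₗ.[ℂ] H} (hT : IsSelfAdjoint T)
    (hF : IsFredholm T) :
    ∃ ε > 0, ∀ μ : ℝ, μ ≠ 0 → |μ| < ε → (μ : ℂ) ∈ resolventSet T := by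
  obtain ⟨C, hC0, hC⟩ := exists_norm_le_of_mem_orthogonal hF
  have := hF.finiteDimensional_eigenspace_zero
  -- For `|μ| < C⁻¹` the term `C |μ| ‖x‖` can be absorbed in the estimate on the orthogonal
  -- complement of the kernel.
  refine ⟨C⁻¹, inv_pos.mpr hC0, fun μ hμ0 hμ => ?_⟩
  have hμ1 : 0 < 1 - C * |μ| := by
    have := mul_lt_mul_of_pos_left hμ hC0
    rw [mul_inv_cancel₀ hC0.ne'] at this
    linarith
  have hμ' : 0 < |μ| := abs_pos.mpr hμ0
  have key : ∀ u : T.domain,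
      ‖(u : H)‖ ≤ (|μ|⁻¹ + (1 - C * |μ|)⁻¹ * C) * ‖subOp T μ u‖ := by
    intro u
    set k : H := (eigenspace T 0).starProjection (u : H) with hk
    have hkK : k ∈ eigenspace T 0 := Submodule.starProjection_apply_mem _ _
    obtain ⟨hkd, hTk⟩ := mem_eigenspace_iff.mp hkK
    rw [zero_smul] at hTk
    set x : T.domain := u - ⟨k, hkd⟩ with hx
    have hxK : (x : H) ∈ (eigenspace T 0)ᗮ :=
      Submodule.sub_starProjection_mem_orthogonal (K := eigenspace T 0) (u : H)
    have hu : u = ⟨k, hkd⟩ + x := by rw [hx]; abel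
    have hsum : subOp T μ u = (μ : ℂ) • k + subOp T μ x := by
      rw [hu, map_add, subOp_apply T μ ⟨k, hkd⟩, hTk, sub_zero]
    -- By symmetry `T x` is orthogonal to the kernel, so the kernel part and the complementary part
    -- of `(μ - T) u` are orthogonal and can be bounded separately.
    have hin : inner ℂ ((μ : ℂ) • k) (subOp T μ x) = 0 := by
      have h1 : inner ℂ k (x : H) = 0 := (Submodule.mem_orthogonal _ _).mp hxK k hkK
      have h2 : inner ℂ k (T x) = 0 := by
        rw [← inner_map_eq hT ⟨k, hkd⟩ x, hTk, inner_zero_left]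
      rw [subOp_apply, inner_smul_left, inner_sub_right, inner_smul_right, h1, h2]
      simp
    have hpyth := norm_add_sq_eq_norm_sq_add_norm_sq_of_inner_eq_zero _ _ hin
    rw [← hsum] at hpyth
    have h1 : |μ| * ‖k‖ ≤ ‖subOp T μ u‖ := by
      have : ‖(μ : ℂ) • k‖ = |μ| * ‖k‖ := by rw [norm_smul, Complex.norm_real, Real.norm_eq_abs]
      rw [← this]
      refine le_of_sq_le_sq ?_ (norm_nonneg _)
      nlinarith [mul_self_nonneg ‖subOp T μ x‖]
    have h2 : ‖subOp T μ x‖ ≤ ‖subOp T μ u‖ := by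
      refine le_of_sq_le_sq ?_ (norm_nonneg _)
      nlinarith [mul_self_nonneg ‖(μ : ℂ) • k‖]
    have h3 : ‖T x‖ ≤ |μ| * ‖(x : H)‖ + ‖subOp T μ x‖ := by
      have e : T x = (μ : ℂ) • (x : H) - subOp T μ x := by rw [subOp_apply]; abel
      rw [e]
      refine (norm_sub_le _ _).trans_eq ?_
      rw [norm_smul, Complex.norm_real, Real.norm_eq_abs]
    have h4 : (1 - C * |μ|) * ‖(x : H)‖ ≤ C * ‖subOp T μ u‖ := by
      have := hC x hxK
      nlinarith
    have h5 : ‖(u : H)‖ ≤ ‖k‖ + ‖(x : H)‖ := by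
      have : (u : H) = k + x := congrArg Subtype.val hu
      rw [this]
      exact norm_add_le _ _
    rw [add_mul, mul_assoc]
    refine h5.trans (add_le_add ?_ ?_)
    · rwa [inv_mul_eq_div, le_div_iff₀ hμ', mul_comm]
    · rwa [inv_mul_eq_div, le_div_iff₀ hμ1, mul_comm]
  refine mem_resolventSet_of_bound hT key fun u hu => ?_
  rw [Complex.conj_ofReal] at hu
  have := key u
  rw [hu, norm_zero, mul_zero] at this
  exact norm_le_zero_iff.mp this

/-- If `0` is the only point of the spectrum in `[-a, a]`, then the spectral projection maps into
the kernel. -/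
theorem range_spectralProjection_le_eigenspace_zero {T : H →ₗ.[ℂ] H} (hT : IsSelfAdjoint T)
    {a : ℝ} (ha : 0 < a) (h : ∀ μ : ℝ, μ ≠ 0 → |μ| ≤ a → (μ : ℂ) ∈ resolventSet T) :
    LinearMap.range (spectralProjection T (-a) a).toLinearMap ≤ eigenspace T 0 := by
  have hI := neg_I_mem_resolventSet hT
  have hN : IsStarNormal (resolventOp T (-Complex.I)) :=
    isStarNormal_resolventOp hT hI (mem_resolventSet_of_im_ne_zero hT (by simp))
  have hp : (a : ℂ) ∈ resolventSet T := h a ha.ne' (abs_of_pos ha).le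
  have hm : ((-a : ℝ) : ℂ) ∈ resolventSet T :=
    h (-a) (neg_ne_zero.mpr ha.ne') (by rw [abs_neg, abs_of_pos ha])
  have hs := continuousOn_spectralSymbol hT hm hp
  -- On the support of the symbol only `μ = 0` occurs, where `(-i - μ)⁻¹ = i`; and `(-i - T)⁻¹ v = i
  -- v` means `T v = 0`.
  have key : resolventOp T (-Complex.I) * spectralProjection T (-a) a =
      Complex.I • spectralProjection T (-a) a := by
    rw [spectralProjection_eq_cfc hT hm hp]
    nth_rw 1 [← cfc_id' ℂ (resolventOp T (-Complex.I))]
    rw [← cfc_mul (fun g => g) _ _ continuousOn_id hs, ← cfc_const_mul _ _ _ hs]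
    refine cfc_congr fun g hg => ?_
    rcases spectralSymbol_cases hT (by linarith) hm hp hg with h0 | ⟨h1, μ, hμ, hμρ, rfl⟩
    · simp only [h0, mul_zero]
    · have hμ0 : μ = 0 := by
        by_contra h0
        exact hμρ (h μ h0 (abs_le.mpr ⟨hμ.1.le, hμ.2.le⟩))
      simp [hμ0]
  rintro _ ⟨y, rfl⟩
  set v : H := spectralProjection T (-a) a y with hv
  have hGv : resolventOp T (-Complex.I) v = Complex.I • v := DFunLike.congr_fun key y
  obtain ⟨u, hu, huv⟩ := exists_resolventOp_eq hI v
  rw [hGv] at hu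
  have hvu : v = -Complex.I • (u : H) := by
    rw [← hu, smul_smul, neg_mul, Complex.I_mul_I, neg_neg, one_smul]
  have hTu : T u = 0 := by
    rw [subOp_apply, ← hvu] at huv
    simpa using huv
  change v ∈ _
  rw [hvu]
  refine Submodule.smul_mem _ _ (mem_eigenspace_iff.mpr ⟨u.2, ?_⟩)
  rw [zero_smul]
  exact hTu

end Fredholm

end

/-! ### Comparison of telescoping sums on two partitions. -/

section Combinatorics

theorem sum_fin_succ_sub_castSucc {m : ℕ} (g : Fin (m + 1) → ℤ) :
    ∑ j : Fin m, (g j.succ - g j.castSucc) = g (Fin.last m) - g 0 := by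
  induction m with
  | zero => simp
  | succ m ih =>
    rw [Fin.sum_univ_castSucc]
    have := ih fun j => g j.castSucc
    simp only [← Fin.succ_castSucc] at this
    rw [this, Fin.succ_last, Fin.castSucc_zero]
    ring

variable {α : Type*} [LinearOrder α]

/-- Clamping the points of `s` to `[p,q]` restricts the subdivision to `[p,q]`; the sum then
telescopes. -/
theorem sum_clamp_sub {m : ℕ} (s : Fin (m + 1) → α) (f : α → ℤ) {p q : α} (hpq : p ≤ q)
    (h0 : s 0 ≤ p) (h1 : q ≤ s (Fin.last m)) :
    ∑ j : Fin m, (f (max p (min (s j.succ) q)) - f (max p (min (s j.castSucc) q))) =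
      f q - f p := by
  rw [sum_fin_succ_sub_castSucc fun j => f (max p (min (s j) q)), min_eq_right h1,
    max_eq_right hpq, min_eq_left (h0.trans hpq), max_eq_left h0]

/-- Two sums of increments along subdivisions of the same interval agree if the increments of the
summands agree on all common subintervals. -/
theorem sum_sub_eq_sum_sub {n m : ℕ} {t : Fin (n + 1) → α} {t' : Fin (m + 1) → α}
    (ht : Monotone t) (ht' : Monotone t') (h0 : t 0 = t' 0)
    (h1 : t (Fin.last n) = t' (Fin.last m)) (F : Fin n → α → ℤ) (F' : Fin m → α → ℤ)
    (h : ∀ i j p q, p ≤ q → t i.castSucc ≤ p → q ≤ t i.succ → t' j.castSucc ≤ p →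
      q ≤ t' j.succ → F i q - F i p = F' j q - F' j p) :
    ∑ i, (F i (t i.succ) - F i (t i.castSucc)) = ∑ j, (F' j (t' j.succ) - F' j (t' j.castSucc)) := by
  have e1 : ∀ i, F i (t i.succ) - F i (t i.castSucc) = ∑ j : Fin m,
      (F i (max (t i.castSucc) (min (t' j.succ) (t i.succ))) -
        F i (max (t i.castSucc) (min (t' j.castSucc) (t i.succ)))) := fun i =>
    (sum_clamp_sub t' (F i) (ht i.castSucc_le_succ) (h0 ▸ ht (Fin.zero_le _))
      (h1 ▸ ht (Fin.le_last _))).symm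
  have e2 : ∀ j, F' j (t' j.succ) - F' j (t' j.castSucc) = ∑ i : Fin n,
      (F' j (max (t' j.castSucc) (min (t i.succ) (t' j.succ))) -
        F' j (max (t' j.castSucc) (min (t i.castSucc) (t' j.succ)))) := fun j =>
    (sum_clamp_sub t (F' j) (ht' j.castSucc_le_succ) (h0 ▸ ht' (Fin.zero_le _))
      (h1 ▸ ht' (Fin.le_last _))).symm
  simp only [e1, e2]
  rw [Finset.sum_comm]
  refine Finset.sum_congr rfl fun j _ => Finset.sum_congr rfl fun i _ => ?_
  have hi : t i.castSucc ≤ t i.succ := ht i.castSucc_le_succ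
  have hj : t' j.castSucc ≤ t' j.succ := ht' j.castSucc_le_succ
  have hF := h i j
  generalize t i.castSucc = a at *
  generalize t i.succ = b at *
  generalize t' j.castSucc = a' at *
  generalize t' j.succ = b' at *
  -- If the two intervals do not overlap, the clamped endpoints coincide and both differences
  -- vanish; otherwise both clamp to `[max a a', min b b']`, where the hypothesis applies.
  rcases le_total b' a with hc | hc
  · rw [min_eq_left (hc.trans hi), min_eq_left (hj.trans (hc.trans hi)), max_eq_left hc,
      max_eq_left (hj.trans hc), min_eq_right (hc.trans hi), min_eq_right hc, sub_self, sub_self]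
  rcases le_total b a' with hc' | hc'
  · rw [min_eq_left (hc'.trans hj), min_eq_left (hi.trans (hc'.trans hj)), max_eq_left hc',
      max_eq_left (hi.trans hc'), min_eq_right (hc'.trans hj), min_eq_right hc', sub_self, sub_self]
  rw [min_eq_left hc, min_eq_left hc', min_comm b b', max_comm a' a,
    max_eq_right (le_min hc hi), max_eq_right (le_min hj hc')]
  exact hF _ _ (max_le (le_min hc hi) (le_min hj hc')) (le_max_left _ _) (min_le_right _ _)
    (le_max_right _ _) (min_le_left _ _)

end Combinatorics

/-! ### Independence of the partition and of the levels. -/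

noncomputable section

variable {H : Type*} [NormedAddCommGroup H] [InnerProductSpace ℂ H] [CompleteSpace H]

omit [CompleteSpace H] in
theorem eigenspaceSum_mono (T : H →ₗ.[ℂ] H) {c d c' d' : ℝ} (hc : c' ≤ c) (hd : d ≤ d') :
    eigenspaceSum T c d ≤ eigenspaceSum T c' d' :=
  biSup_mono fun _ hμ => ⟨hc.trans hμ.1, hμ.2.trans hd⟩

theorem finiteDimensional_eigenspaceSum {T : H →ₗ.[ℂ] H} (hT : IsSelfAdjoint T) {a : ℝ}
    (ha : 0 ≤ a) (hp : (a : ℂ) ∈ resolventSet T) (hm : ((-a : ℝ) : ℂ) ∈ resolventSet T)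
    [FiniteDimensional ℂ (LinearMap.range (spectralProjection T (-a) a).toLinearMap)] :
    FiniteDimensional ℂ (eigenspaceSum T 0 a) :=
  Submodule.finiteDimensional_of_le
    ((eigenspaceSum_mono T (neg_nonpos.mpr ha) le_rfl).trans (eigenspaceSum_le_range hT hm hp))

/-- Split `[0,b]` at `a`. The projection `χ_{[a,b]}` fixes `E_{[a,b]}` and kills `E_{[0,a]}`,
because `a` itself is not an eigenvalue; so the two sums meet only in zero. -/
theorem finrank_eigenspaceSum_eq_add {T : H →ₗ.[ℂ] H} (hT : IsSelfAdjoint T) {a b : ℝ}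
    (ha : 0 < a) (hab : a ≤ b) (hpa : (a : ℂ) ∈ resolventSet T)
    (hpb : (b : ℂ) ∈ resolventSet T) (hmb : ((-b : ℝ) : ℂ) ∈ resolventSet T)
    [FiniteDimensional ℂ (LinearMap.range (spectralProjection T (-b) b).toLinearMap)] :
    Module.finrank ℂ (eigenspaceSum T 0 b) = Module.finrank ℂ (eigenspaceSum T 0 a) +
      Module.finrank ℂ (LinearMap.range (spectralProjection T a b).toLinearMap) := by
  have hfin : FiniteDimensional ℂ (LinearMap.range (spectralProjection T a b).toLinearMap) :=
    Submodule.finiteDimensional_of_le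
      (range_le_range_of_subset hT hab hpa hpb hmb hpb (by linarith) le_rfl)
  rw [range_spectralProjection_eq hT hab hpa hpb]
  have hb : FiniteDimensional ℂ (eigenspaceSum T 0 b) :=
    finiteDimensional_eigenspaceSum hT (ha.le.trans hab) hpb hmb
  have h1 : FiniteDimensional ℂ (eigenspaceSum T 0 a) :=
    Submodule.finiteDimensional_of_le (eigenspaceSum_mono T le_rfl hab)
  have h2 : FiniteDimensional ℂ (eigenspaceSum T a b) :=
    Submodule.finiteDimensional_of_le (eigenspaceSum_mono T ha.le le_rfl)
  have hsup : eigenspaceSum T 0 a ⊔ eigenspaceSum T a b = eigenspaceSum T 0 b := by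
    rw [eigenspaceSum, eigenspaceSum, eigenspaceSum, ← iSup_union,
      Set.Icc_union_Icc_eq_Icc ha.le hab]
  have hker : eigenspaceSum T 0 a ≤ LinearMap.ker (spectralProjection T a b).toLinearMap := by
    refine iSup₂_le fun μ hμ v hv => ?_
    rcases hμ.2.eq_or_lt with rfl | hlt
    · rw [eigenspace_eq_bot hpa, Submodule.mem_bot] at hv
      rw [hv]
      exact zero_mem _
    · exact spectralProjection_apply_of_notMem_Icc hT hab hpa hpb
        (fun h => absurd h.1 (not_le.mpr hlt)) hv
  have hinf : eigenspaceSum T 0 a ⊓ eigenspaceSum T a b = ⊥ := by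
    rw [Submodule.eq_bot_iff]
    rintro v ⟨hv1, hv2⟩
    have e1 : spectralProjection T a b v = 0 := hker hv1
    have e2 : spectralProjection T a b v = v := eigenspaceSum_le_eqLocus hT hpa hpb hv2
    rw [← e2, e1]
  have := Submodule.finrank_sup_add_finrank_inf_eq (eigenspaceSum T 0 a) (eigenspaceSum T a b)
  rwa [hsup, hinf, finrank_bot, add_zero] at this

/-- The increments of `dim E_{[0,a]}` and `dim E_{[0,b]}` agree along a path of operators on which
both levels are admissible. -/
theorem finrank_sub_eq_finrank_sub {A : unitInterval → CFsa H} (hA : Continuous A) {a b : ℝ}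
    (ha : 0 < a) (hab : a ≤ b) {p q : unitInterval} (hpq : p ≤ q)
    (hra : ∀ s ∈ Set.Icc p q, (a : ℂ) ∈ resolventSet (A s).op)
    (hrb : ∀ s ∈ Set.Icc p q,
      (b : ℂ) ∈ resolventSet (A s).op ∧ ((-b : ℝ) : ℂ) ∈ resolventSet (A s).op)
    (hfin : ∀ s ∈ Set.Icc p q, FiniteDimensional ℂ
      (LinearMap.range (spectralProjection (A s).op (-b) b).toLinearMap)) :
    (Module.finrank ℂ (eigenspaceSum (A q).op 0 a) : ℤ) -
        Module.finrank ℂ (eigenspaceSum (A p).op 0 a) =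
      (Module.finrank ℂ (eigenspaceSum (A q).op 0 b) : ℤ) -
        Module.finrank ℂ (eigenspaceSum (A p).op 0 b) := by
  have key : ∀ s ∈ Set.Icc p q, Module.finrank ℂ (eigenspaceSum (A s).op 0 b) =
      Module.finrank ℂ (eigenspaceSum (A s).op 0 a) +
        Module.finrank ℂ (LinearMap.range (spectralProjection (A s).op a b).toLinearMap) :=
    fun s hs => by
      have := hfin s hs
      exact finrank_eigenspaceSum_eq_add (A s).isSelfAdjoint ha hab (hra s hs) (hrb s hs).1 (hrb s hs).2
  have hconst := finrank_range_eq_of_continuousOn (isPreconnected_Icc (a := p) (b := q))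
    (P := fun s => spectralProjection (A s).op a b)
    ((continuousOn_spectralProjection a b).comp hA.continuousOn
      fun s hs => ⟨hra s hs, (hrb s hs).1⟩)
    (fun s hs => isIdempotentElem_spectralProjection (A s).isSelfAdjoint hab (hra s hs) (hrb s hs).1)
    (Set.left_mem_Icc.mpr hpq) (Set.right_mem_Icc.mpr hpq)
  rw [key q (Set.right_mem_Icc.mpr hpq), key p (Set.left_mem_Icc.mpr hpq), hconst]
  push_cast
  ring

theorem IsAdmissible.finiteDimensional_range {A : unitInterval → CFsa H} {n : ℕ}
    {t : Fin (n + 1) → unitInterval} {a : Fin n → ℝ} (h : IsAdmissible A t a) (i : Fin n)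
    {s : unitInterval} (hs : s ∈ Set.Icc (t i.castSucc) (t i.succ)) :
    FiniteDimensional ℂ
      (LinearMap.range (spectralProjection (A s).op (-a i) (a i)).toLinearMap) := by
  obtain ⟨r, hr⟩ := h.rank i
  rw [FiniteDimensional, ← Module.rank_lt_aleph0_iff, hr s hs]
  exact Cardinal.natCast_lt_aleph0

theorem IsAdmissible.flowSum_eq {A : unitInterval → CFsa H} (hA : Continuous A) {n m : ℕ}
    {t : Fin (n + 1) → unitInterval} {a : Fin n → ℝ} {t' : Fin (m + 1) → unitInterval}
    {a' : Fin m → ℝ} (h : IsAdmissible A t a) (h' : IsAdmissible A t' a') :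
    flowSum A t a = flowSum A t' a' := by
  refine sum_sub_eq_sum_sub h.monotone h'.monotone (h.first.trans h'.first.symm)
    (h.last.trans h'.last.symm)
    (fun i s => (Module.finrank ℂ (eigenspaceSum (A s).op 0 (a i)) : ℤ))
    (fun j s => (Module.finrank ℂ (eigenspaceSum (A s).op 0 (a' j)) : ℤ))
    fun i j p q hpq h1 h2 h3 h4 => ?_
  have hs : Set.Icc p q ⊆ Set.Icc (t i.castSucc) (t i.succ) := Set.Icc_subset_Icc h1 h2
  have hs' : Set.Icc p q ⊆ Set.Icc (t' j.castSucc) (t' j.succ) := Set.Icc_subset_Icc h3 h4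
  -- Finite-dimensionality is taken from the larger of the two levels.
  rcases le_total (a i) (a' j) with hab | hab
  · exact finrank_sub_eq_finrank_sub hA (h.pos i) hab hpq
      (fun s hm => (h.mem_resolventSet i s (hs hm)).1)
      (fun s hm => h'.mem_resolventSet j s (hs' hm))
      fun s hm => h'.finiteDimensional_range j (hs' hm)
  · exact (finrank_sub_eq_finrank_sub hA (h'.pos j) hab hpq
      (fun s hm => (h'.mem_resolventSet j s (hs' hm)).1)
      (fun s hm => h.mem_resolventSet i s (hs hm))
      fun s hm => h.finiteDimensional_range i (hs hm)).symm

/-! ### Existence of admissible partitions. -/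

/-- Every selfadjoint Fredholm operator has a neighbourhood with a common admissible level. -/
theorem exists_level (T : CFsa H) :
    ∃ (a : ℝ) (U : Set (CFsa H)) (r : ℕ), 0 < a ∧ IsOpen U ∧ T ∈ U ∧
      (∀ S ∈ U, (a : ℂ) ∈ resolventSet S.op ∧ ((-a : ℝ) : ℂ) ∈ resolventSet S.op) ∧
      ContinuousOn (fun S : CFsa H => spectralProjection S.op (-a) a) U ∧
      ∀ S ∈ U, Module.rank ℂ
        (LinearMap.range (spectralProjection S.op (-a) a).toLinearMap) = r := by
  obtain ⟨ε, hε, h⟩ := exists_forall_mem_resolventSet T.isSelfAdjoint T.isFredholm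
  -- Halving `ε` makes the closed interval `[-a, a]` free of nonzero spectrum.
  have ha : 0 < ε / 2 := half_pos hε
  have hρ : ∀ μ : ℝ, μ ≠ 0 → |μ| ≤ ε / 2 → (μ : ℂ) ∈ resolventSet T.op :=
    fun μ h0 hμ => h μ h0 (hμ.trans_lt (half_lt_self hε))
  generalize ε / 2 = a at ha hρ
  have hp : (a : ℂ) ∈ resolventSet T.op := hρ a ha.ne' (abs_of_pos ha).le
  have hm : ((-a : ℝ) : ℂ) ∈ resolventSet T.op :=
    hρ (-a) (neg_ne_zero.mpr ha.ne') (by rw [abs_neg, abs_of_pos ha])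
  set W := {S : CFsa H | ((-a : ℝ) : ℂ) ∈ resolventSet S.op ∧ (a : ℂ) ∈ resolventSet S.op}
    with hW
  have hWo : IsOpen W :=
    (isOpen_setOf_mem_resolventSet ((-a : ℝ) : ℂ)).inter (isOpen_setOf_mem_resolventSet (a : ℂ))
  have hc : ContinuousOn (fun S : CFsa H => spectralProjection S.op (-a) a) W :=
    continuousOn_spectralProjection (-a) a
  have hfin0 := T.isFredholm.finiteDimensional_eigenspace_zero
  have hfin : FiniteDimensional ℂ
      (LinearMap.range (spectralProjection T.op (-a) a).toLinearMap) :=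
    Submodule.finiteDimensional_of_le (range_spectralProjection_le_eigenspace_zero T.isSelfAdjoint ha hρ)
  set r := Module.finrank ℂ (LinearMap.range (spectralProjection T.op (-a) a).toLinearMap) with hr
  have hrank : Module.rank ℂ
      (LinearMap.range (spectralProjection T.op (-a) a).toLinearMap) = r :=
    (Module.finrank_eq_rank _ _).symm
  -- The neighbourhood consists of the operators with `±a` in the resolvent set whose projection is
  -- at distance less than `1` from that of `T`, so the rank stays `r`.
  have hUo := hc.isOpen_inter_preimage hWo
    (Metric.isOpen_ball (x := spectralProjection T.op (-a) a) (ε := 1))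
  refine ⟨a, _, r, ha, hUo, ⟨⟨hm, hp⟩, ?_⟩, fun S hS => ⟨hS.1.2, hS.1.1⟩,
    hc.mono Set.inter_subset_left, fun S hS => ?_⟩
  · rw [Set.mem_preimage]
    exact Metric.mem_ball_self one_pos
  have hd : dist (spectralProjection S.op (-a) a) (spectralProjection T.op (-a) a) < 1 :=
    Metric.mem_ball.mp (Set.mem_preimage.mp hS.2)
  rw [dist_eq_norm (spectralProjection S.op (-a) a)] at hd
  have hSm : ((-a : ℝ) : ℂ) ∈ resolventSet S.op := hS.1.1
  have hSp : (a : ℂ) ∈ resolventSet S.op := hS.1.2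
  have hTi := isIdempotentElem_spectralProjection T.isSelfAdjoint (by linarith) hm hp
  have hSi := isIdempotentElem_spectralProjection S.isSelfAdjoint (by linarith) hSm hSp
  rw [← hrank, rank_range_eq_of_norm_sub_lt_one hTi hSi hd]

theorem exists_isAdmissible {A : unitInterval → CFsa H} (hA : Continuous A) :
    ∃ (n : ℕ) (t : Fin (n + 1) → unitInterval) (a : Fin n → ℝ), IsAdmissible A t a := by
  choose a U r ha hU hTU hρ hc hr using exists_level (H := H)
  -- The Lebesgue number lemma gives a monotone sequence indexed by `ℕ` that equals `1` from index
  -- `n` on; it is truncated there.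
  obtain ⟨t, ht0, htm, ⟨n, hn⟩, hsub⟩ :=
    exists_monotone_Icc_subset_open_cover_unitInterval
      (c := fun x : unitInterval => A ⁻¹' U (A x)) (fun x => (hU (A x)).preimage hA)
      fun x _ => Set.mem_iUnion.mpr ⟨x, hTU (A x)⟩
  choose x hx using hsub
  refine ⟨n, fun i => t i, fun i => a (A (x i)), ?_⟩
  exact
    { monotone := fun i j hij => htm hij
      first := ht0
      last := hn _ (by simp)
      pos := fun i => ha _
      mem_resolventSet := fun i s hs => hρ _ _ (hx i (by simpa using hs))
      continuousOn := fun i =>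
        (hc (A (x i))).comp hA.continuousOn fun s hs => hx i (by simpa using hs)
      rank := fun i => ⟨r (A (x i)), fun s hs => hr _ _ (hx i (by simpa using hs))⟩ }

end

end SpectralFlow

theorem mainTheorem1 {H : Type*} [NormedAddCommGroup H] [InnerProductSpace ℂ H] [CompleteSpace H]
    (A : unitInterval → SpectralFlow.CFsa H) (hA : Continuous A) :
    (∃ (n : ℕ) (t : Fin (n + 1) → unitInterval) (a : Fin n → ℝ),
      SpectralFlow.IsAdmissible A t a) ∧
    (∀ (n : ℕ) (t : Fin (n + 1) → unitInterval) (a : Fin n → ℝ),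
      SpectralFlow.IsAdmissible A t a →
        ∀ i, ∀ s ∈ Set.Icc (t i.castSucc) (t i.succ),
          FiniteDimensional ℂ (SpectralFlow.eigenspaceSum (A s).op 0 (a i))) ∧
    (∀ (n : ℕ) (t : Fin (n + 1) → unitInterval) (a : Fin n → ℝ)
      (m : ℕ) (t' : Fin (m + 1) → unitInterval) (a' : Fin m → ℝ),
      SpectralFlow.IsAdmissible A t a → SpectralFlow.IsAdmissible A t' a' →
        SpectralFlow.flowSum A t a = SpectralFlow.flowSum A t' a') := by
  refine ⟨SpectralFlow.exists_isAdmissible hA, fun n t a h i s hs => ?_,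
    fun n t a m t' a' h h' => h.flowSum_eq hA h'⟩
  have := h.finiteDimensional_range i hs
  obtain ⟨hp, hm⟩ := h.mem_resolventSet i s hs
  exact SpectralFlow.finiteDimensional_eigenspaceSum (A s).isSelfAdjoint (h.pos i).le hp hm
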